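/- Let $d,d'$ be dimensions, let $G$ be a standard normal random vector in $\mathbb{R}^d$, let $(G_i)_{i\ge 1}$ be an i.i.d. sequence of standard normal random vectors in $\mathbb{R}^d$, let $A\in\mathbb{R}^{d\times d'}$ be a matrix of rank $d'$, and let $f:\mathbb{R}^d\to\mathbb{R}$ be measurable with $$\mathbb{P}(f(G)\neq 0)>0\qquad\text{and}\qquad \mathbb{E}\big(f^2(G)e^{-\theta\cdot G}\big)<\infty\quad\text{for all }\theta\in\mathbb{R}^d.$$ For $n\ge 1$, $\vartheta\in\mathbb{R}^{d'}$ and $\theta\in\mathbb{R}^d$ put $$v_n^{f,A}(\vartheta)=\frac1n\sum_{i=1}^n f^2(G_i)\,e^{-A\vartheta\cdot G_i+|A\vartheta|^2/2},\qquad M_n(\theta,f)=\frac1n\sum_{i=1}^n f(G_i+\theta)\,e^{-\theta\cdot G_i-|\theta|^2/2}.$$ Whenever $f(G_i)\ne 0$ for some $i\le n$ (almost surely the case for all large $n$), $v_n^{f,A}$ has a unique minimizer $\vartheta_n^{f,A}$ on $\mathbb{R}^{d'}$; if $v_n^{f,A}$ does not have a unique minimizer, put $\vartheta_n^{f,A}=0$.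 Let $\theta_n^{f,A}=A\vartheta_n^{f,A}$. For $a\in\mathbb{R}^d$, call $h:\mathbb{R}^d\to\mathbb{R}$ $a$-monotonic if either the functions $t\in\mathbb{R}\mapsto h(x+ta)$, $x\in\mathbb{R}^d$, are all nondecreasing, or they are all nonincreasing. Let $\mathcal{V}_a$ be the set of functions of the form $g_1+g_2$ with $g_1,g_2:\mathbb{R}^d\to\mathbb{R}$ $a$-monotonic and such that, for some $\lambda>0$ and $\beta\in[0,2)$, $|g_i(x)|\le\lambda e^{|x|^\beta}$ for all $x\in\mathbb{R}^d$ and $i=1,2$. When $d'=1$, identify $A$ with its single column, a vector of $\mathbb{R}^d$. Theorem. Assume that $f=f_1+\mathbf{1}_{\{d'=1\}}f_2$, where $f_1:\mathbb{R}^d\to\mathbb{R}$ is continuous with $\mathbb{E}\big(\sup_{|\theta|\le M}|f_1(G+\theta)|\big)<\infty$ for all $M>0$, and where, if $d'=1$, $f_2\in\mathcal{V}_A$. Then, for every deterministic sequence $(\nu_n)_n$ of nonnegative integers with $\nu_n\to\infty$, $$M_n\big(\theta_{\nu_n}^{f,A},f\big)\longrightarrow\mathbb{E}(f(G))\quad\text{almost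 surely as }n\to\infty.$$ -/

import Mathlib

open MeasureTheory ProbabilityTheory Filter Topology

namespace RobustIS

/-- The parameter `θ = Aϑ ∈ ℝ^d` attached to the reduced parameter `ϑ ∈ ℝ^{d'}`. -/
noncomputable def lift {d d' : ℕ} (A : Matrix (Fin d) (Fin d') ℝ)
    (ϑ : EuclideanSpace ℝ (Fin d')) : EuclideanSpace ℝ (Fin d) :=
  Matrix.toLpLin 2 2 A ϑ

/-- The sample variance criterion
`v_n^{f,A}(ϑ) = (1/n) ∑ f²(G_i) exp(- Aϑ·G_i + |Aϑ|²/2)`, evaluated on a sample `y` of points of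
`ℝ^d`. Samples are numbered from `0`, so that `y 0, …, y (n-1)` are the first `n` points. -/
noncomputable def empVar {d d' : ℕ} (f : EuclideanSpace ℝ (Fin d) → ℝ)
    (A : Matrix (Fin d) (Fin d') ℝ) (y : ℕ → EuclideanSpace ℝ (Fin d)) (n : ℕ)
    (ϑ : EuclideanSpace ℝ (Fin d')) : ℝ :=
  (1 / (n : ℝ)) * ∑ i ∈ Finset.range n,
    f (y i) ^ 2 * Real.exp (-(inner ℝ (lift A ϑ) (y i)) + ‖lift A ϑ‖ ^ 2 / 2)

/-- `ϑ` minimizes `v_n^{f,A}` over `ℝ^{d'}`. -/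
def IsMinimizer {d d' : ℕ} (f : EuclideanSpace ℝ (Fin d) → ℝ)
    (A : Matrix (Fin d) (Fin d') ℝ) (y : ℕ → EuclideanSpace ℝ (Fin d)) (n : ℕ)
    (ϑ : EuclideanSpace ℝ (Fin d')) : Prop :=
  ∀ ϑ', empVar f A y n ϑ ≤ empVar f A y n ϑ'

open Classical in
/-- `ϑ_n^{f,A}`: the unique minimizer of `v_n^{f,A}` over `ℝ^{d'}`. It exists as soon as `A` has
rank `d'` and `f (y i) ≠ 0` for one of the first `n` sample points (`existsUnique_isMinimizer`
below); in the remaining case, where `v_n^{f,A}` may vanish identically, it is set to `0`. -/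
noncomputable def optParam {d d' : ℕ} (f : EuclideanSpace ℝ (Fin d) → ℝ)
    (A : Matrix (Fin d) (Fin d') ℝ) (y : ℕ → EuclideanSpace ℝ (Fin d)) (n : ℕ) :
    EuclideanSpace ℝ (Fin d') :=
  if h : ∃! ϑ, IsMinimizer f A y n ϑ then h.choose else 0

/-- The importance sampling estimator
`M_n(θ, g) = (1/n) ∑ g(G_i + θ) exp(- θ·G_i - |θ|²/2)`, evaluated on a sample `y`. -/
noncomputable def estimator {d : ℕ} (g : EuclideanSpace ℝ (Fin d) → ℝ)
    (y : ℕ → EuclideanSpace ℝ (Fin d)) (n : ℕ) (θ : EuclideanSpace ℝ (Fin d)) : ℝ :=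
  (1 / (n : ℝ)) * ∑ i ∈ Finset.range n,
    g (y i + θ) * Real.exp (-(inner ℝ θ (y i)) - ‖θ‖ ^ 2 / 2)

/-- `h` is `a`-monotonic: all the maps `t ↦ h (x + t a)` are nondecreasing, or all of them are
nonincreasing. -/
def DirMonotonic {d : ℕ} (a : EuclideanSpace ℝ (Fin d)) (h : EuclideanSpace ℝ (Fin d) → ℝ) :
    Prop :=
  (∀ x, Monotone fun t : ℝ => h (x + t • a)) ∨ (∀ x, Antitone fun t : ℝ => h (x + t • a))

/-- The growth condition `|g(x)| ≤ lam * exp(|x|^β)` for some `lam > 0` and `β ∈ [0, 2)`. -/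
def SubGaussianGrowth {d : ℕ} (g : EuclideanSpace ℝ (Fin d) → ℝ) : Prop :=
  ∃ lam : ℝ, 0 < lam ∧ ∃ β : ℝ, 0 ≤ β ∧ β < 2 ∧ ∀ x, |g x| ≤ lam * Real.exp (‖x‖ ^ β)

/-- The class `𝒱_a`: sums of two `a`-monotonic functions satisfying the growth condition. -/
def ClassV {d : ℕ} (a : EuclideanSpace ℝ (Fin d)) (h : EuclideanSpace ℝ (Fin d) → ℝ) : Prop :=
  ∃ g₁ g₂ : EuclideanSpace ℝ (Fin d) → ℝ,
    DirMonotonic a g₁ ∧ DirMonotonic a g₂ ∧ SubGaussianGrowth g₁ ∧ SubGaussianGrowth g₂ ∧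
    ∀ x, h x = g₁ x + g₂ x

lemma lift_injective {d d' : ℕ} {A : Matrix (Fin d) (Fin d') ℝ} (hA : A.rank = d') :
    Function.Injective (Matrix.toLpLin 2 2 A) := by
  have h1 : Function.Injective A.mulVecLin := by
    rw [← LinearMap.ker_eq_bot, ← Submodule.finrank_eq_zero]
    have := LinearMap.finrank_range_add_finrank_ker A.mulVecLin
    rw [Matrix.rank] at hA
    simp at this
    omega
  intro x y hxy
  have h2 := congrArg WithLp.ofLp hxy
  rw [Matrix.ofLp_toLpLin, Matrix.ofLp_toLpLin] at h2
  exact WithLp.ofLp_injective 2 (h1 h2)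

lemma continuous_lift {d d' : ℕ} (A : Matrix (Fin d) (Fin d') ℝ) : Continuous (lift A) :=
  LinearMap.continuous_of_finiteDimensional (Matrix.toLpLin 2 2 A)

lemma tendsto_empVar {d d' : ℕ} (f : EuclideanSpace ℝ (Fin d) → ℝ)
    (A : Matrix (Fin d) (Fin d') ℝ) (hA : A.rank = d')
    (y : ℕ → EuclideanSpace ℝ (Fin d)) (n : ℕ) (hn : ∃ i < n, f (y i) ≠ 0) :
    Tendsto (empVar f A y n) (cocompact _) atTop := by
  obtain ⟨j, hj, hfj⟩ := hn
  have hn0 : (0 : ℝ) < n := by exact_mod_cast (by omega : 0 < n)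
  have hT : Tendsto (fun ϑ => ‖lift A ϑ‖) (cocompact _) atTop := by
    obtain ⟨K, _, hK⟩ := LinearMap.exists_antilipschitzWith (Matrix.toLpLin 2 2 A)
      (LinearMap.ker_eq_bot.2 (lift_injective hA))
    have hc := hK.tendsto_cobounded
    rw [← Metric.cobounded_eq_cocompact]
    exact tendsto_norm_cobounded_atTop.comp hc
  have hlow : ∀ ϑ, (1 / (n : ℝ)) * (f (y j) ^ 2 *
      (‖lift A ϑ‖ * (‖lift A ϑ‖ / 2 - ‖y j‖))) ≤ empVar f A y n ϑ := by
    intro ϑ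
    unfold empVar
    refine mul_le_mul_of_nonneg_left ?_ (by positivity)
    refine le_trans ?_ (Finset.single_le_sum (f := fun i => f (y i) ^ 2 *
      Real.exp (-(inner ℝ (lift A ϑ) (y i)) + ‖lift A ϑ‖ ^ 2 / 2))
      (fun i _ => by positivity) (Finset.mem_range.2 hj))
    refine mul_le_mul_of_nonneg_left ?_ (by positivity)
    have h1 := real_inner_le_norm (lift A ϑ) (y j)
    have h2 := Real.add_one_le_exp (-(inner ℝ (lift A ϑ) (y j)) + ‖lift A ϑ‖ ^ 2 / 2)
    nlinarith
  refine tendsto_atTop_mono hlow ?_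
  refine Tendsto.const_mul_atTop (by positivity) (Tendsto.const_mul_atTop (by positivity) ?_)
  refine hT.atTop_mul_atTop₀ ?_
  exact tendsto_atTop_add_const_right _ _ (hT.atTop_div_const two_pos)

/-- `v_n^{f,A}` has exactly one minimizer when `A` has full column rank and `f` does not vanish on
the sample, so that `optParam` is the minimizer. -/
theorem existsUnique_isMinimizer {d d' : ℕ} (f : EuclideanSpace ℝ (Fin d) → ℝ)
    (A : Matrix (Fin d) (Fin d') ℝ) (hA : A.rank = d')
    (y : ℕ → EuclideanSpace ℝ (Fin d)) (n : ℕ) (hn : ∃ i < n, f (y i) ≠ 0) :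
    ∃! ϑ, IsMinimizer f A y n ϑ := by
  have hcont : Continuous (empVar f A y n) := by
    have := continuous_lift A
    unfold empVar
    fun_prop
  obtain ⟨x, hx⟩ := hcont.exists_forall_le (tendsto_empVar f A hA y n hn)
  refine ⟨x, hx, fun z hz => ?_⟩
  obtain ⟨j, hj, hfj⟩ := hn
  have hn0 : (0 : ℝ) < n := by exact_mod_cast (by omega : 0 < n)
  by_contra hne
  have hlne : lift A x - lift A z ≠ 0 :=
    fun h => hne (lift_injective hA (sub_eq_zero.1 h)).symm
  have hpos : 0 < ‖lift A x - lift A z‖ ^ 2 := by positivity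
  -- strict midpoint convexity of each exponential
  have hexp : ∀ i, Real.exp (-(inner ℝ (lift A (midpoint ℝ x z)) (y i)) +
        ‖lift A (midpoint ℝ x z)‖ ^ 2 / 2) <
      (Real.exp (-(inner ℝ (lift A x) (y i)) + ‖lift A x‖ ^ 2 / 2) +
        Real.exp (-(inner ℝ (lift A z) (y i)) + ‖lift A z‖ ^ 2 / 2)) / 2 := by
    intro i
    set p := -(inner ℝ (lift A x) (y i)) + ‖lift A x‖ ^ 2 / 2 with hp
    set q := -(inner ℝ (lift A z) (y i)) + ‖lift A z‖ ^ 2 / 2 with hq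
    have hmid : lift A (midpoint ℝ x z) = (1 / 2 : ℝ) • (lift A x + lift A z) := by
      simp [lift, midpoint_eq_smul_add]
    have hlt : -(inner ℝ (lift A (midpoint ℝ x z)) (y i)) +
        ‖lift A (midpoint ℝ x z)‖ ^ 2 / 2 < p / 2 + q / 2 := by
      have hpar := parallelogram_law_with_norm ℝ (lift A x) (lift A z)
      rw [hmid, real_inner_smul_left, inner_add_left, norm_smul, hp, hq]
      norm_num
      nlinarith
    refine (Real.exp_lt_exp.2 hlt).trans_le ?_
    have h1 : Real.exp (p / 2) ^ 2 = Real.exp p := by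
      rw [← Real.exp_nat_mul]; congr 1; push_cast; ring
    have h2 : Real.exp (q / 2) ^ 2 = Real.exp q := by
      rw [← Real.exp_nat_mul]; congr 1; push_cast; ring
    rw [Real.exp_add]
    nlinarith [sq_nonneg (Real.exp (p / 2) - Real.exp (q / 2))]
  have hlt : empVar f A y n (midpoint ℝ x z) < (empVar f A y n x + empVar f A y n z) / 2 := by
    unfold empVar
    rw [← mul_add, mul_div_assoc, ← Finset.sum_add_distrib, Finset.sum_div]
    refine mul_lt_mul_of_pos_left ?_ (by positivity)
    refine Finset.sum_lt_sum (fun i _ => ?_) ⟨j, Finset.mem_range.2 hj, ?_⟩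
    · rw [← mul_add, mul_div_assoc]
      exact mul_le_mul_of_nonneg_left (hexp i).le (by positivity)
    · rw [← mul_add, mul_div_assoc]
      exact mul_lt_mul_of_pos_left (hexp j) (by positivity)
  have h1 := hx (midpoint ℝ x z)
  have h2 := hz (midpoint ℝ x z)
  linarith

/-- `optParam` is a minimizer of `v_n^{f,A}`. -/
theorem optParam_isMinimizer {d d' : ℕ} (f : EuclideanSpace ℝ (Fin d) → ℝ)
    (A : Matrix (Fin d) (Fin d') ℝ) (hA : A.rank = d')
    (y : ℕ → EuclideanSpace ℝ (Fin d)) (n : ℕ) (hn : ∃ i < n, f (y i) ≠ 0) :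
    IsMinimizer f A y n (optParam f A y n) := by
  have h := existsUnique_isMinimizer f A hA y n hn
  rw [optParam, dif_pos h]
  exact h.choose_spec.1

end RobustIS

/-! The minimizers `optParam` converge almost surely to the strict minimizer `m` of the limiting
`variance` (`exists_tendsto_optParam`): near each point of a small sphere around `m` the empirical
criterion exceeds its value at `m`, finitely many neighbourhoods cover the sphere, and convexity
traps the minimizer inside.

It then suffices that the means of `estTerm` are close to their expectation at `m`, simultaneously
for all parameters near `m`; the sample size `n` and the index `ν n` need no coupling. This local
uniform law (`exists_forall_closedBall_abs_mean_sub_lt`) asks for a local integrable bound and for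
almost sure continuity at the single parameter `m`. By `integral_shift_mul_exp_stdGaussian` the
expectation at `m` is that of `f`.

The bound comes from the growth condition and Fernique's theorem, or from absorbing exponential
weights into shifts by Cameron–Martin. Continuity is clear for `f₁`. For `f₂`, every line of
direction `A` carries countably many discontinuities, so Fubini and quasi-invariance of the Gaussian
under shifts make the bad set null. It need not be Borel, but it is universally measurable, being
built from projections of Borel sets. -/

/-! ### Universal measurability of projections and suprema -/

/-- Continuous images of subsets of the Baire space can be exhausted, up to small measure, by
continuous images of compact boxes. -/
theorem exists_isCompact_subset_range_of_lt_measure {α : Type*} [TopologicalSpace α]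
    [TopologicalSpace.PseudoMetrizableSpace α] [T2Space α] [MeasurableSpace α] [BorelSpace α]
    (μ : Measure α) [IsFiniteMeasure μ] {f : (ℕ → ℕ) → α} (hf : Continuous f)
    {c : ENNReal} (hc : c < μ (Set.range f)) :
    ∃ K ⊆ Set.range f, IsCompact K ∧ c ≤ μ K := by
  -- Bounding one more coordinate keeps the measure above `c`: continuity from below, valid for
  -- arbitrary increasing sets.
  have step : ∀ (k : ℕ) (S : Set (ℕ → ℕ)), ∃ m, c < μ (f '' S) →
      c < μ (f '' (S ∩ {x | x k ≤ m})) := by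
    intro k S
    by_cases h : c < μ (f '' S)
    · have hU : f '' S = ⋃ m, f '' (S ∩ {x | x k ≤ m}) := by
        rw [← Set.image_iUnion, ← Set.inter_iUnion]
        congr 1
        refine (Set.inter_eq_left.2 fun x _ => ?_).symm
        exact Set.mem_iUnion.2 ⟨x k, le_refl (x k)⟩
      have hm : Monotone fun m : ℕ => f '' (S ∩ {x | x k ≤ m}) := fun m m' hmm =>
        Set.image_mono (Set.inter_subset_inter_right _ fun x (hx : x k ≤ m) => hx.trans hmm)
      rw [hU, hm.measure_iUnion] at h
      obtain ⟨m, hm⟩ := lt_iSup_iff.1 h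
      exact ⟨m, fun _ => hm⟩
    · exact ⟨0, fun h' => absurd h' h⟩
  choose m hm using step
  let C : ℕ → Set (ℕ → ℕ) := fun k =>
    Nat.rec Set.univ (fun k S => S ∩ {x | x k ≤ m k S}) k
  let N : ℕ → ℕ := fun k => m k (C k)
  have hC : ∀ k, c < μ (f '' C k) := by
    intro k
    induction k with
    | zero => simpa [C] using hc
    | succ k ih => exact hm k _ ih
  have hCN : ∀ k, C k = {x | ∀ i < k, x i ≤ N i} := by
    intro k
    induction k with
    | zero => simp [C]
    | succ k ih =>
      have : C (k + 1) = C k ∩ {x | x k ≤ N k} := rfl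
      rw [this, ih]
      ext x
      exact Nat.forall_lt_succ_right.symm
  let K : Set (ℕ → ℕ) := Set.Iic N
  have hK : IsCompact K := by
    have : K = Set.pi Set.univ fun i => Set.Iic (N i) := by ext x; simp [K, Pi.le_def]
    rw [this]
    exact isCompact_univ_pi fun i => (Set.finite_Iic _).isCompact
  refine ⟨f '' K, Set.image_subset_range _ _, hK.image hf, ?_⟩
  -- Continuity from above is not at hand for the images of the `C k`; instead every open `U ⊇ f ''
  -- K` is shown to contain some `f '' C k`.
  rw [Set.measure_eq_iInf_isOpen]
  refine le_iInf₂ fun U hKU => le_iInf fun hU => ?_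
  suffices h : ∃ k, C k ⊆ f ⁻¹' U by
    obtain ⟨k, hk⟩ := h
    exact (hC k).le.trans (measure_mono (Set.image_subset_iff.2 hk))
  by_contra hcon
  simp only [not_exists, Set.not_subset] at hcon
  choose x hx hxU using hcon
  -- The truncation `x k ⊓ N` lies in the compact box and agrees with `x k` in the first `k`
  -- coordinates, so both have the same subsequential limit.
  obtain ⟨y, hyK, φ, hφ, hy⟩ := hK.tendsto_subseq (x := fun k => x k ⊓ N) fun k => Set.mem_Iic.2 inf_le_right
  have hxy : Tendsto (x ∘ φ) atTop (𝓝 y) := by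
    rw [tendsto_pi_nhds] at hy ⊢
    intro i
    refine (hy i).congr' ?_
    filter_upwards [eventually_gt_atTop i] with k hk
    have := hx (φ k)
    rw [hCN] at this
    exact inf_eq_left.2 (this i (hk.trans_le (hφ.id_le k)))
  have hyU : f y ∈ U := hKU ⟨y, hyK, rfl⟩
  obtain ⟨k, hk⟩ := (hxy.eventually ((hU.preimage hf).mem_nhds hyU)).exists
  exact hxU _ hk

/-- Analytic sets are universally measurable. -/
theorem MeasureTheory.AnalyticSet.nullMeasurableSet {α : Type*} [TopologicalSpace α]
    [TopologicalSpace.PseudoMetrizableSpace α] [T2Space α] [MeasurableSpace α] [BorelSpace α]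
    {s : Set α} (hs : AnalyticSet s) (μ : Measure α) [IsFiniteMeasure μ] :
    NullMeasurableSet s μ := by
  rw [AnalyticSet] at hs
  obtain rfl | ⟨f, hf, rfl⟩ := hs
  · exact MeasurableSet.empty.nullMeasurableSet
  rcases eq_zero_or_pos (μ (Set.range f)) with h0 | h0
  · exact .of_null h0
  obtain ⟨u, -, hu, hut⟩ := exists_seq_strictMono_tendsto' h0
  choose K hKs hKc hK using fun n =>
    exists_isCompact_subset_range_of_lt_measure μ hf (hu n).2
  have hmeas : MeasurableSet (⋃ n, K n) := .iUnion fun n => (hKc n).measurableSet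
  refine hmeas.nullMeasurableSet.congr (ae_eq_of_subset_of_measure_ge (Set.iUnion_subset hKs) ?_
    hmeas.nullMeasurableSet (measure_ne_top _ _))
  exact le_of_tendsto' hut fun n => (hK n).trans (measure_mono (Set.subset_iUnion K n))

/-- The projection of a Borel set is universally measurable. -/
theorem nullMeasurableSet_exists {α β : Type*} [TopologicalSpace α]
    [PolishSpace α] [MeasurableSpace α] [BorelSpace α]
    [MeasurableSpace β] [StandardBorelSpace β] (μ : Measure α) [IsFiniteMeasure μ]
    {s : Set (α × β)} (hs : MeasurableSet s) : NullMeasurableSet {x | ∃ y, (x, y) ∈ s} μ := by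
  have : {x | ∃ y, (x, y) ∈ s} = Prod.fst '' s := by ext; simp
  rw [this]
  exact (hs.analyticSet_image measurable_fst).nullMeasurableSet μ

/-- The supremum of a jointly measurable function over a measurable set of parameters is
measurable for the completion of any finite measure. -/
theorem aemeasurable_biSup_param {α β : Type*} [TopologicalSpace α]
    [PolishSpace α] [MeasurableSpace α] [BorelSpace α]
    [MeasurableSpace β] [StandardBorelSpace β] (μ : Measure α) [IsFiniteMeasure μ]
    {q : α → β → ENNReal} (hq : Measurable (Function.uncurry q)) {s : Set β}
    (hs : MeasurableSet s) : AEMeasurable (fun x => ⨆ y ∈ s, q x y) μ := by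
  refine NullMeasurable.aemeasurable (μ := μ) ?_
  have h : @Measurable (NullMeasurableSpace α μ) _ _ _ fun x => ⨆ y ∈ s, q x y := by
    refine measurable_of_Ioi fun c => ?_
    -- Strict superlevel sets of a supremum are projections of Borel sets.
    have : (fun x => ⨆ y ∈ s, q x y) ⁻¹' Set.Ioi c =
        {x | ∃ y, (x, y) ∈ Function.uncurry q ⁻¹' Set.Ioi c ∩ Prod.snd ⁻¹' s} := by
      ext x
      simp [lt_iSup_iff, and_comm]
    exact this ▸ nullMeasurableSet_exists μ ((hq measurableSet_Ioi).inter (measurable_snd hs))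
  exact fun t ht => h ht

/-! ### Oscillation at a point -/

/-- The modulus of continuity of `f` at `t₀` over the ball of radius `1 / (n + 1)`. -/
noncomputable def oscAt {Θ : Type*} [PseudoMetricSpace Θ] (f : Θ → ℝ) (t₀ : Θ) (n : ℕ) : ENNReal :=
  ⨆ t ∈ Metric.closedBall t₀ (1 / ((n : ℝ) + 1)), ‖f t - f t₀‖ₑ

theorem antitone_oscAt {Θ : Type*} [PseudoMetricSpace Θ] (f : Θ → ℝ) (t₀ : Θ) :
    Antitone (oscAt f t₀) := fun _ _ h =>
  biSup_mono fun _ ht => Metric.closedBall_subset_closedBall (Nat.one_div_le_one_div h) ht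

/-- Countably many radii suffice, so measurability of the set of continuity reduces to that of each
`oscAt`. -/
theorem continuousAt_iff_iInf_oscAt {Θ : Type*} [PseudoMetricSpace Θ] {f : Θ → ℝ} {t₀ : Θ} :
    ContinuousAt f t₀ ↔ ⨅ n, oscAt f t₀ n = 0 := by
  constructor
  · intro h
    refine le_antisymm (ENNReal.le_of_forall_pos_le_add fun ε hε _ => ?_) zero_le
    rw [zero_add]
    obtain ⟨δ, hδ, hδε⟩ := Metric.continuousAt_iff.1 h ε (by exact_mod_cast hε)
    obtain ⟨n, hn⟩ := exists_nat_one_div_lt hδ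
    refine iInf_le_of_le n (iSup₂_le fun t ht => ?_)
    have := hδε (lt_of_le_of_lt (Metric.mem_closedBall.1 ht) hn)
    rw [← edist_eq_enorm_sub, edist_nndist]
    exact_mod_cast this.le
  · intro h
    rw [Metric.continuousAt_iff']
    intro ε hε
    have : ⨅ n, oscAt f t₀ n < ENNReal.ofReal ε := by rw [h]; simpa using hε
    obtain ⟨n, hn⟩ := iInf_lt_iff.1 this
    filter_upwards [Metric.closedBall_mem_nhds t₀ (Nat.one_div_pos_of_nat (n := n) (α := ℝ))]
      with t ht
    have h1 : ‖f t - f t₀‖ₑ < ENNReal.ofReal ε :=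
      lt_of_le_of_lt (le_iSup₂ (f := fun t _ => ‖f t - f t₀‖ₑ) t ht) hn
    rwa [← edist_eq_enorm_sub, edist_lt_ofReal] at h1

theorem aemeasurable_oscAt {α Θ : Type*} [TopologicalSpace α] [PolishSpace α] [MeasurableSpace α]
    [BorelSpace α] [PseudoMetricSpace Θ] [MeasurableSpace Θ] [StandardBorelSpace Θ]
    [OpensMeasurableSpace Θ] (μ : Measure α) [IsFiniteMeasure μ] {q : α → Θ → ℝ}
    (hq : Measurable (Function.uncurry q)) (t₀ : Θ) (n : ℕ) :
    AEMeasurable (fun x => oscAt (q x) t₀ n) μ := by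
  refine aemeasurable_biSup_param μ (q := fun x t => ‖q x t - q x t₀‖ₑ) ?_
    Metric.isClosed_closedBall.measurableSet
  exact (hq.sub (hq.comp (measurable_fst.prodMk measurable_const))).enorm

/-- For a jointly measurable family of functions, the set of those that are continuous at a given
point is universally measurable. -/
theorem nullMeasurableSet_continuousAt {α Θ : Type*} [TopologicalSpace α] [PolishSpace α]
    [MeasurableSpace α] [BorelSpace α] [PseudoMetricSpace Θ] [MeasurableSpace Θ]
    [StandardBorelSpace Θ] [OpensMeasurableSpace Θ] (μ : Measure α) [IsFiniteMeasure μ]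
    {q : α → Θ → ℝ} (hq : Measurable (Function.uncurry q)) (t₀ : Θ) :
    NullMeasurableSet {x | ContinuousAt (q x) t₀} μ := by
  simp_rw [continuousAt_iff_iInf_oscAt]
  exact (AEMeasurable.iInf fun n => aemeasurable_oscAt μ hq t₀ n).nullMeasurable
    (measurableSet_singleton 0)

theorem oscAt_le_two_mul {α Θ : Type*} [PseudoMetricSpace Θ] {q : α → Θ → ℝ} {t₀ : Θ}
    {B : α → ENNReal} (hqB : ∀ x, ∀ t ∈ Metric.closedBall t₀ 1, ‖q x t‖ₑ ≤ B x) (n : ℕ)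
    (x : α) : oscAt (q x) t₀ n ≤ 2 * B x := by
  refine iSup₂_le fun t ht => ?_
  have h1 : (1 : ℝ) / (n + 1) ≤ 1 := by
    rw [div_le_one (by positivity)]; linarith [n.cast_nonneg (α := ℝ)]
  calc ‖q x t - q x t₀‖ₑ ≤ ‖q x t‖ₑ + ‖q x t₀‖ₑ := enorm_sub_le
    _ ≤ B x + B x := add_le_add (hqB x t (Metric.closedBall_subset_closedBall h1 ht))
        (hqB x t₀ (Metric.mem_closedBall_self zero_le_one))
    _ = 2 * B x := (two_mul _).symm

/-! ### Laws of large numbers, pointwise and locally uniform -/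

section EmpiricalMeans

variable {α Ω Θ : Type*} [MeasurableSpace α] [MeasurableSpace Ω] {P : Measure Ω}
  {μ : Measure α} {X : ℕ → Ω → α}

theorem ae_forall_of_hasLaw (hX : ∀ i, HasLaw (X i) μ P) {p : α → Prop} (hp : ∀ᵐ x ∂μ, p x) :
    ∀ᵐ ω ∂P, ∀ i, p (X i ω) := by
  refine ae_all_iff.2 fun i => ae_of_ae_map (hX i).aemeasurable ?_
  rwa [(hX i).map_eq]

/-- The strong law of large numbers for functions of an i.i.d. sequence. -/
theorem strong_law_ae_comp (hX : ∀ i, HasLaw (X i) μ P) (hind : iIndepFun X P) {φ : α → ℝ}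
    (hφ : Integrable φ μ) :
    ∀ᵐ ω ∂P, Tendsto (fun n : ℕ => (1 / (n : ℝ)) * ∑ i ∈ Finset.range n, φ (X i ω)) atTop
      (𝓝 (∫ x, φ x ∂μ)) := by
  have hφi : ∀ i, AEStronglyMeasurable φ (P.map (X i)) := fun i => by
    rw [(hX i).map_eq]; exact hφ.aestronglyMeasurable
  have h := strong_law_ae_real (μ := P) (fun i => φ ∘ X i)
    (by
      refine Integrable.comp_aemeasurable ?_ (hX 0).aemeasurable
      rwa [(hX 0).map_eq])
    (fun i j hij => (hind.indepFun hij).comp₀ (hX i).aemeasurable (hX j).aemeasurable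
      (hφi i).aemeasurable (hφi j).aemeasurable)
    (fun i => ((hX i).identDistrib (hX 0)).comp_of_aemeasurable (hφi i).aemeasurable)
  have h0 : ∫ ω, (φ ∘ X 0) ω ∂P = ∫ x, φ x ∂μ := by
    rw [← (hX 0).map_eq, integral_map (hX 0).aemeasurable (hφi 0)]
    rfl
  filter_upwards [h] with ω hω
  rw [← h0]
  refine hω.congr fun n => ?_
  simp [div_eq_inv_mul]

variable [PseudoMetricSpace Θ] [MeasurableSpace Θ] {q : α → Θ → ℝ} {t₀ : Θ} {B : α → ENNReal}

theorem integrable_of_enorm_le (hq : Measurable (Function.uncurry q))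
    (hqB : ∀ x, ∀ t ∈ Metric.closedBall t₀ 1, ‖q x t‖ₑ ≤ B x) (hB : ∫⁻ x, B x ∂μ ≠ ⊤)
    {t : Θ} (ht : t ∈ Metric.closedBall t₀ 1) : Integrable (fun x => q x t) μ := by
  refine ⟨(hq.comp (measurable_id.prodMk measurable_const)).aestronglyMeasurable, ?_⟩
  exact (lintegral_mono fun x => hqB x t ht).trans_lt hB.lt_top

variable [TopologicalSpace α] [PolishSpace α] [BorelSpace α] [IsFiniteMeasure μ]
  [StandardBorelSpace Θ] [OpensMeasurableSpace Θ]

/-- Dominated convergence: the oscillations decrease to `0` at points of continuity and are at most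
`2 * B`. -/
theorem tendsto_lintegral_oscAt (hq : Measurable (Function.uncurry q))
    (hcont : ∀ᵐ x ∂μ, ContinuousAt (q x) t₀)
    (hqB : ∀ x, ∀ t ∈ Metric.closedBall t₀ 1, ‖q x t‖ₑ ≤ B x) (hB : ∫⁻ x, B x ∂μ ≠ ⊤) :
    Tendsto (fun n => ∫⁻ x, oscAt (q x) t₀ n ∂μ) atTop (𝓝 0) := by
  rw [← lintegral_zero (μ := μ)]
  refine tendsto_lintegral_of_dominated_convergence' (fun x => 2 * B x)
    (fun n => aemeasurable_oscAt μ hq t₀ n) (fun n => ae_of_all _ (oscAt_le_two_mul hqB n)) ?_ ?_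
  · rw [lintegral_const_mul' _ _ (by simp)]
    exact ENNReal.mul_ne_top (by simp) hB
  · filter_upwards [hcont] with x hx
    rw [← continuousAt_iff_iInf_oscAt.1 hx]
    exact tendsto_atTop_iInf (antitone_oscAt _ _)

theorem continuousAt_integral_param (hq : Measurable (Function.uncurry q))
    (hcont : ∀ᵐ x ∂μ, ContinuousAt (q x) t₀)
    (hqB : ∀ x, ∀ t ∈ Metric.closedBall t₀ 1, ‖q x t‖ₑ ≤ B x) (hB : ∫⁻ x, B x ∂μ ≠ ⊤) :
    ContinuousAt (fun t => ∫ x, q x t ∂μ) t₀ := by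
  rw [Metric.continuousAt_iff']
  intro ε hε
  have h := (tendsto_lintegral_oscAt hq hcont hqB hB).eventually_lt_const
    (u := ENNReal.ofReal ε) (by simpa using hε)
  obtain ⟨n, hn⟩ := h.exists
  filter_upwards [Metric.closedBall_mem_nhds t₀ (Nat.one_div_pos_of_nat (n := n) (α := ℝ)),
    Metric.closedBall_mem_nhds t₀ one_pos] with t ht ht1
  rw [← edist_lt_ofReal, edist_eq_enorm_sub, ← integral_sub
    (integrable_of_enorm_le hq hqB hB ht1)
    (integrable_of_enorm_le hq hqB hB (Metric.mem_closedBall_self zero_le_one))]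
  refine ((enorm_integral_le_lintegral_enorm _).trans (lintegral_mono fun x => ?_)).trans_lt hn
  exact le_iSup₂ (f := fun t _ => ‖q x t - q x t₀‖ₑ) t ht

/-- A local uniform law of large numbers: around a parameter at which almost all functions of a
locally dominated family are continuous, empirical means stay close to the expectation. -/
theorem exists_forall_closedBall_abs_mean_sub_lt (hX : ∀ i, HasLaw (X i) μ P)
    (hind : iIndepFun X P) (hq : Measurable (Function.uncurry q))
    (hcont : ∀ᵐ x ∂μ, ContinuousAt (q x) t₀)
    (hqB : ∀ x, ∀ t ∈ Metric.closedBall t₀ 1, ‖q x t‖ₑ ≤ B x) (hB : ∫⁻ x, B x ∂μ ≠ ⊤)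
    {ε : ℝ} (hε : 0 < ε) :
    ∃ δ > 0, ∀ᵐ ω ∂P, ∀ᶠ n : ℕ in atTop, ∀ t ∈ Metric.closedBall t₀ δ,
      |(1 / (n : ℝ)) * ∑ i ∈ Finset.range n, q (X i ω) t - ∫ x, q x t₀ ∂μ| < ε := by
  have h := (tendsto_lintegral_oscAt hq hcont hqB hB).eventually_lt_const
    (u := ENNReal.ofReal (ε / 2)) (by simpa using hε)
  obtain ⟨k, hk⟩ := h.exists
  refine ⟨1 / ((k : ℝ) + 1), by positivity, ?_⟩
  have hW := aemeasurable_oscAt μ hq t₀ k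
  have hfin : ∀ᵐ x ∂μ, oscAt (q x) t₀ k < ⊤ := ae_lt_top' hW hk.ne_top
  -- Two applications of the strong law are enough: the mean oscillation controls all `t` in the
  -- ball at once, and the second one treats `t₀` itself.
  have h1 := strong_law_ae_comp hX hind (integrable_toReal_of_lintegral_ne_top hW hk.ne_top)
  have h2 := strong_law_ae_comp hX hind
    (integrable_of_enorm_le hq hqB hB (Metric.mem_closedBall_self zero_le_one))
  have hlt : ∫ x, (oscAt (q x) t₀ k).toReal ∂μ < ε / 2 := by
    rw [integral_toReal hW hfin]
    exact (ENNReal.lt_ofReal_iff_toReal_lt hk.ne_top).1 hk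
  filter_upwards [h1, h2, ae_forall_of_hasLaw hX hfin] with ω hω1 hω2 hω3
  filter_upwards [hω1.eventually_lt_const hlt, Metric.tendsto_nhds.1 hω2 (ε / 2) (by positivity)]
    with n hn1 hn2 t ht
  have hle : |(1 / (n : ℝ)) * ∑ i ∈ Finset.range n, q (X i ω) t -
      (1 / (n : ℝ)) * ∑ i ∈ Finset.range n, q (X i ω) t₀| ≤
      (1 / (n : ℝ)) * ∑ i ∈ Finset.range n, (oscAt (q (X i ω)) t₀ k).toReal := by
    rw [← mul_sub, ← Finset.sum_sub_distrib, abs_mul, abs_of_nonneg (by positivity : 0 ≤ 1 / (n : ℝ))]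
    refine mul_le_mul_of_nonneg_left ?_ (by positivity)
    refine (Finset.abs_sum_le_sum_abs _ _).trans (Finset.sum_le_sum fun i _ => ?_)
    have h3 : ‖q (X i ω) t - q (X i ω) t₀‖ₑ ≤ oscAt (q (X i ω)) t₀ k :=
      le_iSup₂ (f := fun t _ => ‖q (X i ω) t - q (X i ω) t₀‖ₑ) t ht
    have h4 := ENNReal.toReal_mono (hω3 i).ne h3
    rwa [toReal_enorm, Real.norm_eq_abs] at h4
  rw [Real.dist_eq] at hn2
  calc _ ≤ _ := abs_sub_le _ ((1 / (n : ℝ)) * ∑ i ∈ Finset.range n, q (X i ω) t₀) _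
    _ < ε / 2 + ε / 2 := add_lt_add (hle.trans_lt hn1) hn2
    _ = ε := by ring

end EmpiricalMeans

/-! ### Subquadratic growth -/

theorem exists_rpow_le_add_mul_sq {β : ℝ} (hβ0 : 0 ≤ β) (hβ : β < 2) {ε : ℝ} (hε : 0 < ε) :
    ∃ C, 0 ≤ C ∧ ∀ r : ℝ, 0 ≤ r → r ^ β ≤ C + ε * r ^ 2 := by
  have h := (tendsto_rpow_neg_atTop (sub_pos.2 hβ)).eventually_le_const hε
  obtain ⟨K, hK⟩ := eventually_atTop.1 h
  refine ⟨max K 1 ^ β, by positivity, fun r hr => ?_⟩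
  rcases le_or_gt (max K 1) r with hKr | hKr
  · have hr0 : 0 < r := lt_of_lt_of_le (by simp) hKr
    have h1 := hK r ((le_max_left _ _).trans hKr)
    have h2 : r ^ β = r ^ (-(2 - β)) * r ^ 2 := by
      rw [← Real.rpow_natCast, ← Real.rpow_add hr0]; norm_num
    have h3 : 0 ≤ max K 1 ^ β := by positivity
    rw [h2]
    nlinarith [sq_nonneg r]
  · have := Real.rpow_le_rpow hr hKr.le hβ0
    nlinarith [mul_nonneg hε.le (sq_nonneg r)]

/-- Subquadratic growth is dominated by an arbitrarily small multiple of the square. -/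
theorem exists_rpow_add_mul_le_add_mul_sq {β : ℝ} (hβ0 : 0 ≤ β) (hβ : β < 2) (c R : ℝ)
    (hc : 0 ≤ c) {ε : ℝ} (hε : 0 < ε) :
    ∃ C, ∀ r : ℝ, 0 ≤ r → (r + c) ^ β + R * r ≤ C + ε * r ^ 2 := by
  -- With `ε / 4`, the bound `(r + c)² ≤ 2r² + 2c²` uses up half of `ε * r²`; the other half absorbs
  -- `R * r` by completing the square.
  obtain ⟨C, -, hC⟩ := exists_rpow_le_add_mul_sq hβ0 hβ (ε := ε / 4) (by positivity)
  refine ⟨C + ε / 2 * c ^ 2 + R ^ 2 / (2 * ε), fun r hr => ?_⟩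
  have h1 := hC (r + c) (by positivity)
  have h2 : R * r ≤ R ^ 2 / (2 * ε) + ε / 2 * r ^ 2 := by
    have : 0 ≤ (R - ε * r) ^ 2 / (2 * ε) := by positivity
    have h3 : (R - ε * r) ^ 2 / (2 * ε) = R ^ 2 / (2 * ε) + ε / 2 * r ^ 2 - R * r := by
      field_simp; ring
    linarith
  nlinarith [mul_nonneg hε.le (sq_nonneg (r - c))]

/-! ### Gaussian integrability, shifts and null sets -/

/-- The Cameron–Martin density of the translate of a standard Gaussian by `θ`. -/
noncomputable def shiftDensity {E : Type*} [NormedAddCommGroup E] [InnerProductSpace ℝ E]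
    (θ x : E) : ℝ :=
  Real.exp (inner ℝ θ x - ‖θ‖ ^ 2 / 2)

theorem shiftDensity_pos {E : Type*} [NormedAddCommGroup E] [InnerProductSpace ℝ E] (θ x : E) :
    0 < shiftDensity θ x := Real.exp_pos _

@[fun_prop]
theorem measurable_shiftDensity {E : Type*} [NormedAddCommGroup E] [InnerProductSpace ℝ E]
    [MeasurableSpace E] [BorelSpace E] (θ : E) : Measurable (shiftDensity θ) := by
  unfold shiftDensity; fun_prop

section Gaussian

variable {E : Type*} [NormedAddCommGroup E] [InnerProductSpace ℝ E] [FiniteDimensional ℝ E]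
  [MeasurableSpace E] [BorelSpace E]

/-- Fernique's theorem gives a square-exponential moment, which dominates any subquadratic exponent.
-/
theorem integrable_exp_rpow_norm_stdGaussian {β : ℝ} (hβ0 : 0 ≤ β) (hβ : β < 2) {c : ℝ}
    (hc : 0 ≤ c) (R : ℝ) :
    Integrable (fun x : E => Real.exp ((‖x‖ + c) ^ β + R * ‖x‖)) (stdGaussian E) := by
  obtain ⟨ε, hε, hint⟩ := IsGaussian.exists_integrable_exp_sq (stdGaussian E)
  obtain ⟨C, hC⟩ := exists_rpow_add_mul_le_add_mul_sq hβ0 hβ c R hc hε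
  refine (hint.const_mul (Real.exp C)).mono' ?_ (ae_of_all _ fun x => ?_)
  · exact Measurable.aestronglyMeasurable (by fun_prop)
  · rw [Real.norm_eq_abs, Real.abs_exp, ← Real.exp_add]
    exact Real.exp_le_exp.2 (hC _ (norm_nonneg x))

theorem integrable_exp_inner_stdGaussian (θ : E) :
    Integrable (fun x => Real.exp (inner ℝ θ x)) (stdGaussian E) := by
  refine (integrable_exp_rpow_norm_stdGaussian (E := E) le_rfl two_pos le_rfl ‖θ‖).mono' ?_
    (ae_of_all _ fun x => ?_)
  · exact Measurable.aestronglyMeasurable (by fun_prop)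
  · rw [Real.norm_eq_abs, Real.abs_exp]
    refine Real.exp_le_exp.2 ?_
    have := real_inner_le_norm θ x
    simp only [Real.rpow_zero]
    linarith

theorem integrable_shiftDensity (θ : E) : Integrable (shiftDensity θ) (stdGaussian E) := by
  have h : shiftDensity θ = fun x => Real.exp (inner ℝ θ x) * (Real.exp (‖θ‖ ^ 2 / 2))⁻¹ := by
    ext x
    rw [shiftDensity, Real.exp_sub, div_eq_mul_inv]
  rw [h]
  exact (integrable_exp_inner_stdGaussian θ).mul_const _

/-- In orthonormal coordinates this is a product of one-dimensional complex moment generating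
functions `exp (z ^ 2 / 2)`. It yields the characteristic function of the tilted measure in the
Cameron–Martin formula. -/
theorem integral_cexp_inner_stdGaussian (θ t : E) :
    ∫ x, Complex.exp ((inner ℝ θ x : ℝ) + (inner ℝ x t : ℝ) * Complex.I) ∂stdGaussian E =
      Complex.exp (‖θ‖ ^ 2 / 2 - ‖t‖ ^ 2 / 2 + (inner ℝ θ t : ℝ) * Complex.I) := by
  let b := stdOrthonormalBasis ℝ E
  rw [stdGaussian, integral_map (Measurable.aemeasurable (by fun_prop))
    (Measurable.aestronglyMeasurable (by fun_prop))]
  let z : Fin (Module.finrank ℝ E) → ℂ := fun i =>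
    (inner ℝ θ (b i) : ℝ) + (inner ℝ (b i) t : ℝ) * Complex.I
  have h1 : ∀ x : Fin (Module.finrank ℝ E) → ℝ,
      Complex.exp ((inner ℝ θ (∑ i, x i • b i) : ℝ) +
        (inner ℝ (∑ i, x i • b i) t : ℝ) * Complex.I) = ∏ i, Complex.exp (z i * x i) := by
    intro x
    rw [← Complex.exp_sum]
    congr 1
    simp only [sum_inner, inner_sum, inner_smul_left, inner_smul_right, z]
    push_cast
    rw [Finset.sum_mul, ← Finset.sum_add_distrib]
    refine Finset.sum_congr rfl fun i _ => ?_
    simp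
    ring
  have h2 : ∀ i, ∫ x : ℝ, Complex.exp (z i * x) ∂gaussianReal 0 1 = Complex.exp (z i ^ 2 / 2) := by
    intro i
    have := complexMGF_id_gaussianReal (μ := 0) (v := 1) (z i)
    simpa [complexMGF] using this
  simp_rw [b] at h1
  simp_rw [h1]
  rw [integral_fintype_prod_eq_prod (𝕜 := ℂ) (f := fun i (x : ℝ) => Complex.exp (z i * x))]
  simp_rw [h2]
  rw [← Complex.exp_sum]
  congr 1
  have e1 : ‖θ‖ ^ 2 = ∑ i, inner ℝ θ (b i) ^ 2 := (b.sum_sq_inner_left θ).symm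
  have e2 : ‖t‖ ^ 2 = ∑ i, inner ℝ (b i) t ^ 2 := (b.sum_sq_inner_right t).symm
  have e3 : inner ℝ θ t = ∑ i, inner ℝ θ (b i) * inner ℝ (b i) t := (b.sum_inner_mul_inner θ t).symm
  rw [e3, ← Complex.ofReal_pow, ← Complex.ofReal_pow, e1, e2]
  push_cast
  rw [Finset.sum_div, Finset.sum_div, Finset.sum_mul, ← Finset.sum_sub_distrib,
    ← Finset.sum_add_distrib]
  refine Finset.sum_congr rfl fun i _ => ?_
  simp only [z]
  ring_nf
  rw [Complex.I_sq]
  ring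

/-- The **Cameron–Martin formula** for the standard Gaussian measure. -/
theorem stdGaussian_map_add_const (θ : E) :
    (stdGaussian E).map (· + θ) =
      (stdGaussian E).withDensity fun x => ENNReal.ofReal (shiftDensity θ x) := by
  have hfin := isFiniteMeasure_withDensity_ofReal (integrable_shiftDensity θ).2
  have : IsProbabilityMeasure ((stdGaussian E).map (· + θ)) :=
    Measure.isProbabilityMeasure_map (by fun_prop)
  refine Measure.ext_of_charFun (funext fun t => ?_)
  rw [charFun_map_add_const, charFun_stdGaussian, charFun_apply,
    integral_withDensity_eq_integral_toReal_smul (by fun_prop) (by simp)]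
  simp_rw [ENNReal.toReal_ofReal (shiftDensity_pos _ _).le, Complex.real_smul]
  have h : ∀ x : E, ((shiftDensity θ x : ℝ) : ℂ) * Complex.exp ((inner ℝ x t : ℝ) * Complex.I) =
      Complex.exp ((inner ℝ θ x : ℝ) + (inner ℝ x t : ℝ) * Complex.I) *
        Complex.exp (-(‖θ‖ ^ 2 / 2)) := by
    intro x
    rw [shiftDensity, Complex.ofReal_exp, ← Complex.exp_add, ← Complex.exp_add]
    congr 1
    push_cast
    ring
  simp_rw [h]
  rw [integral_mul_const, integral_cexp_inner_stdGaussian, ← Complex.exp_add, ← Complex.exp_add]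
  congr 1
  ring

theorem lintegral_stdGaussian_add_const {g : E → ENNReal} (hg : Measurable g) (θ : E) :
    ∫⁻ x, g (x + θ) ∂stdGaussian E =
      ∫⁻ x, ENNReal.ofReal (shiftDensity θ x) * g x ∂stdGaussian E := by
  rw [← lintegral_map hg (measurable_add_const θ), stdGaussian_map_add_const,
    lintegral_withDensity_eq_lintegral_mul _ (by fun_prop) hg]
  rfl

theorem absolutelyContinuous_stdGaussian_map_add_const (θ : E) :
    stdGaussian E ≪ (stdGaussian E).map (· + θ) := by
  rw [stdGaussian_map_add_const]
  exact withDensity_absolutelyContinuous' (by fun_prop)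
    (ae_of_all _ fun x => by simpa using shiftDensity_pos θ x)

/-- Importance sampling by a Gaussian shift is unbiased. -/
theorem integral_shift_mul_exp_stdGaussian {f : E → ℝ} (hf : Measurable f) (θ : E) :
    ∫ x, f (x + θ) * Real.exp (-(inner ℝ θ x) - ‖θ‖ ^ 2 / 2) ∂stdGaussian E =
      ∫ x, f x ∂stdGaussian E := by
  have h : ∀ x, f (x + θ) * Real.exp (-(inner ℝ θ x) - ‖θ‖ ^ 2 / 2) =
      (fun y => f y * (shiftDensity θ y)⁻¹) (x + θ) := by
    intro x
    simp only [shiftDensity, ← Real.exp_neg, inner_add_right, real_inner_self_eq_norm_sq]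
    congr 2
    ring
  simp_rw [h]
  rw [← integral_map (φ := fun x => x + θ) (f := fun y => f y * (shiftDensity θ y)⁻¹)
    (by fun_prop) (hf.mul (measurable_shiftDensity θ).inv).aestronglyMeasurable, stdGaussian_map_add_const,
    integral_withDensity_eq_integral_toReal_smul (by fun_prop) (by simp)]
  refine integral_congr_ae (ae_of_all _ fun x => ?_)
  have := shiftDensity_pos θ x
  simp only [ENNReal.toReal_ofReal this.le, smul_eq_mul]
  field_simp

/-- A universally measurable set that meets all lines of a given direction in countable sets is
a Gaussian null set. -/
theorem stdGaussian_eq_zero_of_countable_lines {D : Set E}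
    (hD : NullMeasurableSet D (stdGaussian E)) (a : E)
    (hline : ∀ x, {t : ℝ | x + t • a ∈ D}.Countable) : stdGaussian E D = 0 := by
  -- Fubini needs a Borel set; passing to a subset of equal measure keeps the line sections
  -- countable.
  obtain ⟨D', hD'D, hD', hae⟩ := hD.exists_measurable_subset_ae_eq
  rw [← measure_congr hae]
  let S : Set (ℝ × E) := {p | p.2 + p.1 • a ∈ D'}
  have hS : MeasurableSet S :=
    (show Measurable fun p : ℝ × E => p.2 + p.1 • a by fun_prop) hD'
  have h0 : (volume.prod (stdGaussian E)) S = 0 := by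
    rw [Measure.prod_apply_symm hS]
    refine (lintegral_congr fun x => ?_).trans lintegral_zero
    have hsub : {t : ℝ | x + t • a ∈ D'} ⊆ {t : ℝ | x + t • a ∈ D} := fun t ht => hD'D ht
    exact ((hline x).mono hsub).measure_zero _
  rw [Measure.measure_prod_null hS] at h0
  -- One null translate of `D'` along `a` is enough, since the Gaussian is absolutely continuous
  -- with respect to its shifts.
  obtain ⟨t, ht⟩ := h0.exists
  refine absolutelyContinuous_stdGaussian_map_add_const (t • a) ?_
  rw [Measure.map_apply (by fun_prop) hD']
  exact ht

end Gaussian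

/-! ### Linear functionals against the norm; localization of convex minimizers -/

/-- A multiple of the norm is dominated by the maximum of finitely many linear functionals. -/
theorem exists_finset_mul_norm_le_inner (E : Type*) [NormedAddCommGroup E] [InnerProductSpace ℝ E]
    [FiniteDimensional ℝ E] (R : ℝ) :
    ∃ T : Finset E, ∀ x : E, ∃ θ ∈ T, R * ‖x‖ ≤ inner ℝ θ x := by
  classical
  obtain ⟨t, -, ht⟩ := (isCompact_sphere (0 : E) 1).elim_nhds_subcover
    (fun u => {x | R < inner ℝ ((R + 1) • u) x}) (fun u hu => by
      refine (isOpen_lt continuous_const (by fun_prop)).mem_nhds ?_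
      have : ‖u‖ = 1 := by simpa using hu
      simp [real_inner_smul_left, this])
  refine ⟨insert 0 (t.image fun u => (R + 1) • u), fun x => ?_⟩
  rcases eq_or_ne x 0 with rfl | hx
  · exact ⟨0, by simp, by simp⟩
  have hx0 : 0 < ‖x‖ := norm_pos_iff.2 hx
  have hmem : ‖x‖⁻¹ • x ∈ Metric.sphere (0 : E) 1 := by
    simp [norm_smul, hx0.ne']
  obtain ⟨u, hu, hux⟩ := Set.mem_iUnion₂.1 (ht hmem)
  refine ⟨(R + 1) • u, by simp only [Finset.mem_insert, Finset.mem_image]; exact .inr ⟨u, hu, rfl⟩,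
    ?_⟩
  rw [Set.mem_ofPred_eq, real_inner_smul_right, inv_mul_eq_div, lt_div_iff₀ hx0] at hux
  exact hux.le

/-- This replaces exponentials of the norm by exponentials of linear functionals, to which the
moment hypothesis and Cameron–Martin apply. -/
theorem exists_finset_exp_mul_norm_le (E : Type*) [NormedAddCommGroup E] [InnerProductSpace ℝ E]
    [FiniteDimensional ℝ E] (R : ℝ) :
    ∃ T : Finset E, ∀ x : E, Real.exp (R * ‖x‖) ≤ ∑ θ ∈ T, Real.exp (inner ℝ θ x) := by
  obtain ⟨T, hT⟩ := exists_finset_mul_norm_le_inner E R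
  refine ⟨T, fun x => ?_⟩
  obtain ⟨θ, hθ, h⟩ := hT x
  exact (Real.exp_le_exp.2 h).trans (Finset.single_le_sum (f := fun θ => Real.exp (inner ℝ θ x))
    (fun _ _ => (Real.exp_pos _).le) hθ)

/-- If a convex function exceeds its value at `m` on a sphere around `m`, then its minimizers lie
inside of the sphere. -/
theorem ConvexOn.dist_lt_of_forall_sphere_lt {E : Type*} [NormedAddCommGroup E] [NormedSpace ℝ E]
    {g : E → ℝ} (hg : ConvexOn ℝ Set.univ g) {m p : E} {ε : ℝ} (hε : 0 < ε)
    (hp : ∀ x, g p ≤ g x) (hs : ∀ x ∈ Metric.sphere m ε, g m < g x) : dist p m < ε := by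
  by_contra! h
  have h0 : 0 < dist p m := hε.trans_le h
  have hlam : ε / dist p m ≤ 1 := (div_le_one h0).2 h
  -- The weight `ε / dist p m` on `p` selects the point where the segment from `m` to `p` crosses
  -- the sphere.
  have hc := hg.2 (Set.mem_univ p) (Set.mem_univ m)
    (show 0 ≤ ε / dist p m by positivity) (sub_nonneg.2 hlam) (by ring)
  have hmem : (ε / dist p m) • p + (1 - ε / dist p m) • m ∈ Metric.sphere m ε := by
    have : (ε / dist p m) • p + (1 - ε / dist p m) • m - m = (ε / dist p m) • (p - m) := by
      module
    rw [mem_sphere_iff_norm, this, norm_smul, ← dist_eq_norm, Real.norm_eq_abs,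
      abs_of_pos (by positivity)]
    field_simp
  have h1 := hs _ hmem
  have h2 := hp m
  simp only [smul_eq_mul] at hc
  nlinarith [mul_le_mul_of_nonneg_left h2 (by positivity : 0 ≤ ε / dist p m)]

/-! ### The variance criterion and consistency of its empirical minimizers -/

namespace RobustIS

variable {d d' : ℕ}

theorem lift_add (A : Matrix (Fin d) (Fin d') ℝ) (x y : EuclideanSpace ℝ (Fin d')) :
    lift A (x + y) = lift A x + lift A y := map_add _ _ _

theorem lift_smul (A : Matrix (Fin d) (Fin d') ℝ) (c : ℝ) (x : EuclideanSpace ℝ (Fin d')) :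
    lift A (c • x) = c • lift A x := map_smul _ _ _

@[fun_prop]
theorem measurable_lift (A : Matrix (Fin d) (Fin d') ℝ) : Measurable (lift A) :=
  (continuous_lift A).measurable

theorem exists_forall_closedBall_norm_lift_le (A : Matrix (Fin d) (Fin d') ℝ)
    (t₀ : EuclideanSpace ℝ (Fin d')) :
    ∃ R, 0 < R ∧ ∀ t ∈ Metric.closedBall t₀ 1, ‖lift A t‖ ≤ R := by
  obtain ⟨C, hC⟩ := (isCompact_closedBall t₀ 1).exists_bound_of_continuousOn
    (continuous_lift A).continuousOn
  exact ⟨max C 1, by positivity, fun t ht => (hC t ht).trans (le_max_left _ _)⟩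

theorem convexOn_empVar (f : EuclideanSpace ℝ (Fin d) → ℝ) (A : Matrix (Fin d) (Fin d') ℝ)
    (y : ℕ → EuclideanSpace ℝ (Fin d)) (n : ℕ) : ConvexOn ℝ Set.univ (empVar f A y n) := by
  have hexp : ∀ z : EuclideanSpace ℝ (Fin d), ConvexOn ℝ Set.univ
      fun ϑ => Real.exp (-(inner ℝ (lift A ϑ) z) + ‖lift A ϑ‖ ^ 2 / 2) := by
    intro z
    refine ⟨convex_univ, fun x _ y _ a b ha hb hab => ?_⟩
    refine le_trans (Real.exp_le_exp.2 ?_)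
      (convexOn_exp.2 (Set.mem_univ _) (Set.mem_univ _) ha hb hab)
    have h1 : ‖a • lift A x + b • lift A y‖ ^ 2 ≤ (a * ‖lift A x‖ + b * ‖lift A y‖) ^ 2 := by
      refine pow_le_pow_left₀ (norm_nonneg _) ((norm_add_le _ _).trans_eq ?_) 2
      rw [norm_smul, norm_smul, Real.norm_of_nonneg ha, Real.norm_of_nonneg hb]
    have h2 : (a * ‖lift A x‖ + b * ‖lift A y‖) ^ 2 ≤
        a * ‖lift A x‖ ^ 2 + b * ‖lift A y‖ ^ 2 := by
      obtain rfl : b = 1 - a := by linarith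
      nlinarith [mul_nonneg (mul_nonneg ha hb) (sq_nonneg (‖lift A x‖ - ‖lift A y‖))]
    simp only [lift_add, lift_smul, inner_add_left, real_inner_smul_left, smul_eq_mul]
    linarith
  unfold empVar
  have hs : ConvexOn ℝ Set.univ fun ϑ => ∑ i ∈ Finset.range n, f (y i) ^ 2 *
      Real.exp (-(inner ℝ (lift A ϑ) (y i)) + ‖lift A ϑ‖ ^ 2 / 2) := by
    induction n with
    | zero => simpa using convexOn_const 0 convex_univ
    | succ n ih =>
      simp_rw [Finset.sum_range_succ]
      exact ih.add ((hexp (y n)).smul (sq_nonneg (f (y n))))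
  exact hs.smul (by positivity)

/-- The integrand of the variance criterion. -/
noncomputable def varTerm (f : EuclideanSpace ℝ (Fin d) → ℝ) (A : Matrix (Fin d) (Fin d') ℝ)
    (x : EuclideanSpace ℝ (Fin d)) (ϑ : EuclideanSpace ℝ (Fin d')) : ℝ :=
  f x ^ 2 * Real.exp (-(inner ℝ (lift A ϑ) x) + ‖lift A ϑ‖ ^ 2 / 2)

/-- The variance criterion `v(ϑ) = E (f²(G) exp(- Aϑ·G + |Aϑ|²/2))`. -/
noncomputable def variance (f : EuclideanSpace ℝ (Fin d) → ℝ) (A : Matrix (Fin d) (Fin d') ℝ)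
    (ϑ : EuclideanSpace ℝ (Fin d')) : ℝ :=
  ∫ x, varTerm f A x ϑ ∂stdGaussian (EuclideanSpace ℝ (Fin d))

theorem empVar_eq (f : EuclideanSpace ℝ (Fin d) → ℝ) (A : Matrix (Fin d) (Fin d') ℝ)
    (y : ℕ → EuclideanSpace ℝ (Fin d)) (n : ℕ) (ϑ : EuclideanSpace ℝ (Fin d')) :
    empVar f A y n ϑ = (1 / (n : ℝ)) * ∑ i ∈ Finset.range n, varTerm f A (y i) ϑ := rfl

variable {f : EuclideanSpace ℝ (Fin d) → ℝ} {A : Matrix (Fin d) (Fin d') ℝ}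

theorem measurable_uncurry_varTerm (hf : Measurable f) (A : Matrix (Fin d) (Fin d') ℝ) :
    Measurable (Function.uncurry (varTerm f A)) := by
  unfold varTerm Function.uncurry
  fun_prop

theorem continuous_varTerm (f : EuclideanSpace ℝ (Fin d) → ℝ) (A : Matrix (Fin d) (Fin d') ℝ)
    (x : EuclideanSpace ℝ (Fin d)) : Continuous (varTerm f A x) := by
  have := continuous_lift A
  unfold varTerm
  fun_prop

theorem exists_forall_closedBall_enorm_varTerm_le
    (hf_int : ∀ θ : EuclideanSpace ℝ (Fin d), Integrable
      (fun x => f x ^ 2 * Real.exp (-(inner ℝ θ x))) (stdGaussian (EuclideanSpace ℝ (Fin d))))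
    (A : Matrix (Fin d) (Fin d') ℝ) (t₀ : EuclideanSpace ℝ (Fin d')) :
    ∃ B : EuclideanSpace ℝ (Fin d) → ENNReal,
      (∀ x, ∀ t ∈ Metric.closedBall t₀ 1, ‖varTerm f A x t‖ₑ ≤ B x) ∧
      ∫⁻ x, B x ∂stdGaussian (EuclideanSpace ℝ (Fin d)) ≠ ⊤ := by
  obtain ⟨R, hR, hA⟩ := exists_forall_closedBall_norm_lift_le A t₀
  obtain ⟨T, hT⟩ := exists_finset_exp_mul_norm_le (EuclideanSpace ℝ (Fin d)) R
  have hint : Integrable (fun x => ∑ θ ∈ T, f x ^ 2 * Real.exp (-(inner ℝ (-θ) x)) *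
      Real.exp (R ^ 2 / 2)) (stdGaussian (EuclideanSpace ℝ (Fin d))) :=
    integrable_finsetSum _ fun θ _ => (hf_int (-θ)).mul_const _
  refine ⟨_, fun x t ht => ?_, hint.2.ne⟩
  rw [enorm_le_iff_norm_le]
  refine le_trans ?_ (le_abs_self _)
  have h1 : ‖varTerm f A x t‖ ≤ f x ^ 2 * (Real.exp (R * ‖x‖) * Real.exp (R ^ 2 / 2)) := by
    rw [varTerm, norm_mul, Real.norm_eq_abs, Real.norm_eq_abs, Real.abs_exp,
      abs_of_nonneg (sq_nonneg _), ← Real.exp_add]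
    refine mul_le_mul_of_nonneg_left (Real.exp_le_exp.2 ?_) (sq_nonneg _)
    have h2 := neg_le_of_abs_le (abs_real_inner_le_norm (lift A t) x)
    have h3 := mul_le_mul_of_nonneg_right (hA t ht) (norm_nonneg x)
    have h4 := pow_le_pow_left₀ (norm_nonneg _) (hA t ht) 2
    linarith
  refine h1.trans ?_
  beta_reduce
  rw [← Finset.sum_mul, ← Finset.mul_sum, ← mul_assoc]
  simp only [inner_neg_left, neg_neg]
  gcongr
  exact hT x

theorem integrable_varTerm (hf : Measurable f)
    (hf_int : ∀ θ : EuclideanSpace ℝ (Fin d), Integrable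
      (fun x => f x ^ 2 * Real.exp (-(inner ℝ θ x))) (stdGaussian (EuclideanSpace ℝ (Fin d))))
    (A : Matrix (Fin d) (Fin d') ℝ) (t : EuclideanSpace ℝ (Fin d')) :
    Integrable (fun x => varTerm f A x t) (stdGaussian (EuclideanSpace ℝ (Fin d))) := by
  obtain ⟨B, hB, hB'⟩ := exists_forall_closedBall_enorm_varTerm_le hf_int A t
  exact integrable_of_enorm_le (measurable_uncurry_varTerm hf A) hB hB'
    (Metric.mem_closedBall_self zero_le_one)

theorem continuous_variance (hf : Measurable f)
    (hf_int : ∀ θ : EuclideanSpace ℝ (Fin d), Integrable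
      (fun x => f x ^ 2 * Real.exp (-(inner ℝ θ x))) (stdGaussian (EuclideanSpace ℝ (Fin d))))
    (A : Matrix (Fin d) (Fin d') ℝ) : Continuous (variance f A) := by
  refine continuous_iff_continuousAt.2 fun t => ?_
  obtain ⟨B, hB, hB'⟩ := exists_forall_closedBall_enorm_varTerm_le hf_int A t
  exact continuousAt_integral_param (measurable_uncurry_varTerm hf A)
    (ae_of_all _ fun x => (continuous_varTerm f A x).continuousAt) hB hB'

theorem variance_pos (hf : Measurable f)
    (hf_ne : 0 < stdGaussian (EuclideanSpace ℝ (Fin d)) {x | f x ≠ 0})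
    (hf_int : ∀ θ : EuclideanSpace ℝ (Fin d), Integrable
      (fun x => f x ^ 2 * Real.exp (-(inner ℝ θ x))) (stdGaussian (EuclideanSpace ℝ (Fin d))))
    (A : Matrix (Fin d) (Fin d') ℝ) (t : EuclideanSpace ℝ (Fin d')) : 0 < variance f A t := by
  rw [variance, integral_pos_iff_support_of_nonneg _ (integrable_varTerm hf hf_int A t)]
  · convert hf_ne using 2
    ext x
    simp [varTerm]
  · intro x
    simp only [varTerm, Pi.zero_apply]
    positivity

theorem lift_midpoint (A : Matrix (Fin d) (Fin d') ℝ) (x z : EuclideanSpace ℝ (Fin d')) :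
    lift A (midpoint ℝ x z) = midpoint ℝ (lift A x) (lift A z) := by
  simp [lift, midpoint_eq_smul_add]

/-- By the parallelogram law the exponent at the midpoint is the average of the two exponents minus
`‖lift A s - lift A t‖ ^ 2 / 8`. This deterministic factor makes strict convexity survive
integration. -/
theorem variance_midpoint_le (hf : Measurable f)
    (hf_int : ∀ θ : EuclideanSpace ℝ (Fin d), Integrable
      (fun x => f x ^ 2 * Real.exp (-(inner ℝ θ x))) (stdGaussian (EuclideanSpace ℝ (Fin d))))
    (A : Matrix (Fin d) (Fin d') ℝ) (s t : EuclideanSpace ℝ (Fin d')) :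
    variance f A (midpoint ℝ s t) ≤
      Real.exp (-(‖lift A s - lift A t‖ ^ 2 / 8)) * ((variance f A s + variance f A t) / 2) := by
  have hs := integrable_varTerm hf hf_int A s
  have ht := integrable_varTerm hf hf_int A t
  unfold variance
  rw [← integral_add hs ht, ← integral_div, ← integral_const_mul]
  refine integral_mono (integrable_varTerm hf hf_int A _) (((hs.add ht).div_const _).const_mul _)
    fun x => ?_
  simp only [varTerm]
  set p := -(inner ℝ (lift A s) x) + ‖lift A s‖ ^ 2 / 2 with hp
  set q := -(inner ℝ (lift A t) x) + ‖lift A t‖ ^ 2 / 2 with hq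
  have hexp : -(inner ℝ (lift A (midpoint ℝ s t)) x) + ‖lift A (midpoint ℝ s t)‖ ^ 2 / 2 =
      -(‖lift A s - lift A t‖ ^ 2 / 8) + (p / 2 + q / 2) := by
    have hpar := parallelogram_law_with_norm ℝ (lift A s) (lift A t)
    rw [lift_midpoint, midpoint_eq_smul_add, real_inner_smul_left, inner_add_left, norm_smul, hp,
      hq]
    norm_num
    nlinarith
  have h1 : Real.exp (p / 2) ^ 2 = Real.exp p := by
    rw [← Real.exp_nat_mul]; congr 1; push_cast; ring
  have h2 : Real.exp (q / 2) ^ 2 = Real.exp q := by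
    rw [← Real.exp_nat_mul]; congr 1; push_cast; ring
  have h3 : Real.exp (p / 2 + q / 2) ≤ (Real.exp p + Real.exp q) / 2 := by
    rw [Real.exp_add]
    nlinarith [sq_nonneg (Real.exp (p / 2) - Real.exp (q / 2))]
  rw [hexp, Real.exp_add]
  calc _ ≤ f x ^ 2 * (Real.exp (-(‖lift A s - lift A t‖ ^ 2 / 8)) *
        ((Real.exp p + Real.exp q) / 2)) := by gcongr
    _ = _ := by ring

theorem tendsto_norm_lift (hA : A.rank = d') :
    Tendsto (fun ϑ => ‖lift A ϑ‖) (cocompact _) atTop := by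
  obtain ⟨K, _, hK⟩ := LinearMap.exists_antilipschitzWith (Matrix.toLpLin 2 2 A)
    (LinearMap.ker_eq_bot.2 (lift_injective hA))
  have hc := hK.tendsto_cobounded
  rw [← Metric.cobounded_eq_cocompact]
  exact tendsto_norm_cobounded_atTop.comp hc

/-- The bound `u + 1 ≤ exp u` under the integral gives a quadratic in `‖lift A ϑ‖` with positive
leading coefficient `E (f ^ 2) / 2`; full rank sends this norm to infinity. -/
theorem tendsto_variance_cocompact (hA : A.rank = d') (hf : Measurable f)
    (hf_ne : 0 < stdGaussian (EuclideanSpace ℝ (Fin d)) {x | f x ≠ 0})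
    (hf_int : ∀ θ : EuclideanSpace ℝ (Fin d), Integrable
      (fun x => f x ^ 2 * Real.exp (-(inner ℝ θ x))) (stdGaussian (EuclideanSpace ℝ (Fin d)))) :
    Tendsto (variance f A) (cocompact _) atTop := by
  have hsq : Integrable (fun x => f x ^ 2) (stdGaussian (EuclideanSpace ℝ (Fin d))) := by
    simpa using hf_int 0
  have hsq0 : 0 < ∫ x, f x ^ 2 ∂stdGaussian (EuclideanSpace ℝ (Fin d)) := by
    have := variance_pos hf hf_ne hf_int A 0
    simpa [variance, varTerm, lift] using this
  have hnorm : Integrable (fun x => f x ^ 2 * ‖x‖) (stdGaussian (EuclideanSpace ℝ (Fin d))) := by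
    obtain ⟨T, hT⟩ := exists_finset_exp_mul_norm_le (EuclideanSpace ℝ (Fin d)) 1
    refine Integrable.mono' (g := fun x => ∑ θ ∈ T, f x ^ 2 * Real.exp (-(inner ℝ (-θ) x)))
      (integrable_finsetSum _ fun θ _ => hf_int (-θ))
      (Measurable.aestronglyMeasurable (by fun_prop)) (ae_of_all _ fun x => ?_)
    rw [Real.norm_of_nonneg (by positivity)]
    simp only [inner_neg_left, neg_neg]
    rw [← Finset.mul_sum]
    have h1 := hT x
    have h2 := Real.add_one_le_exp (1 * ‖x‖)
    gcongr
    linarith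
  set a := ∫ x, f x ^ 2 ∂stdGaussian (EuclideanSpace ℝ (Fin d))
  set b := ∫ x, f x ^ 2 * ‖x‖ ∂stdGaussian (EuclideanSpace ℝ (Fin d))
  have hlow : ∀ ϑ, ‖lift A ϑ‖ * (‖lift A ϑ‖ * (a / 2) - b) ≤ variance f A ϑ := by
    intro ϑ
    have : ‖lift A ϑ‖ * (‖lift A ϑ‖ * (a / 2) - b) =
        ∫ x, (‖lift A ϑ‖ ^ 2 / 2 * f x ^ 2 - ‖lift A ϑ‖ * (f x ^ 2 * ‖x‖))
          ∂stdGaussian (EuclideanSpace ℝ (Fin d)) := by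
      rw [integral_sub (hsq.const_mul _) (hnorm.const_mul _), integral_const_mul,
        integral_const_mul]
      ring
    rw [this]
    refine integral_mono ((hsq.const_mul _).sub (hnorm.const_mul _))
      (integrable_varTerm hf hf_int A ϑ) fun x => ?_
    have h1 := real_inner_le_norm (lift A ϑ) x
    have h2 := Real.add_one_le_exp (-(inner ℝ (lift A ϑ) x) + ‖lift A ϑ‖ ^ 2 / 2)
    have h3 : ‖lift A ϑ‖ ^ 2 / 2 - ‖lift A ϑ‖ * ‖x‖ ≤
      Real.exp (-(inner ℝ (lift A ϑ) x) + ‖lift A ϑ‖ ^ 2 / 2) := by linarith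
    calc _ = f x ^ 2 * (‖lift A ϑ‖ ^ 2 / 2 - ‖lift A ϑ‖ * ‖x‖) := by ring
      _ ≤ _ := mul_le_mul_of_nonneg_left h3 (sq_nonneg _)
  have hT := tendsto_norm_lift hA
  refine tendsto_atTop_mono hlow (hT.atTop_mul_atTop₀ ?_)
  exact tendsto_atTop_add_const_right _ _ (hT.atTop_mul_const (by positivity))

/-- The variance criterion has a strict minimizer. -/
theorem exists_forall_ne_variance_lt (hA : A.rank = d') (hf : Measurable f)
    (hf_ne : 0 < stdGaussian (EuclideanSpace ℝ (Fin d)) {x | f x ≠ 0})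
    (hf_int : ∀ θ : EuclideanSpace ℝ (Fin d), Integrable
      (fun x => f x ^ 2 * Real.exp (-(inner ℝ θ x))) (stdGaussian (EuclideanSpace ℝ (Fin d)))) :
    ∃ m, ∀ t, t ≠ m → variance f A m < variance f A t := by
  obtain ⟨m, hm⟩ := (continuous_variance hf hf_int A).exists_forall_le
    (tendsto_variance_cocompact hA hf hf_ne hf_int)
  refine ⟨m, fun t ht => (hm t).lt_of_ne fun heq => ?_⟩
  have hne : lift A m - lift A t ≠ 0 := fun h => ht (lift_injective hA (sub_eq_zero.1 h)).symm
  have h1 := variance_midpoint_le hf hf_int A m t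
  have h2 := hm (midpoint ℝ m t)
  have h3 := variance_pos hf hf_ne hf_int A m
  have h4 : Real.exp (-(‖lift A m - lift A t‖ ^ 2 / 8)) < 1 := by
    rw [Real.exp_lt_one_iff]
    have : 0 < ‖lift A m - lift A t‖ ^ 2 := by positivity
    linarith
  rw [← heq, add_self_div_two] at h1
  nlinarith

/-- Strong consistency of the empirical minimizers. -/
theorem exists_tendsto_optParam {Ω : Type*} [MeasurableSpace Ω] {P : Measure Ω}
    {G : ℕ → Ω → EuclideanSpace ℝ (Fin d)}
    (hGlaw : ∀ i, HasLaw (G i) (stdGaussian (EuclideanSpace ℝ (Fin d))) P)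
    (hGindep : iIndepFun G P) (hA : A.rank = d') (hf : Measurable f)
    (hf_ne : 0 < stdGaussian (EuclideanSpace ℝ (Fin d)) {x | f x ≠ 0})
    (hf_int : ∀ θ : EuclideanSpace ℝ (Fin d), Integrable
      (fun x => f x ^ 2 * Real.exp (-(inner ℝ θ x))) (stdGaussian (EuclideanSpace ℝ (Fin d)))) :
    ∃ m, ∀ᵐ ω ∂P, Tendsto (fun n => optParam f A (fun i => G i ω) n) atTop (𝓝 m) := by
  obtain ⟨m, hm⟩ := exists_forall_ne_variance_lt hA hf hf_ne hf_int
  refine ⟨m, ?_⟩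
  have hlln := strong_law_ae_comp hGlaw hGindep (integrable_varTerm hf hf_int A m)
  have hsph : ∀ ε : ℝ, 0 < ε → ∀ᵐ ω ∂P, ∀ᶠ n : ℕ in atTop, ∀ t ∈ Metric.sphere m ε,
      empVar f A (fun i => G i ω) n m < empVar f A (fun i => G i ω) n t := by
    intro ε hε
    have hloc : ∀ s ∈ Metric.sphere m ε, ∃ δ > 0, ∀ᵐ ω ∂P, ∀ᶠ n : ℕ in atTop,
        ∀ t ∈ Metric.closedBall s δ,
        empVar f A (fun i => G i ω) n m < empVar f A (fun i => G i ω) n t := by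
      intro s hs
      have hsm := hm s (Metric.ne_of_mem_sphere hs hε.ne')
      obtain ⟨B, hB, hB'⟩ := exists_forall_closedBall_enorm_varTerm_le hf_int A s
      -- The tolerance is half the gap between the variances at `s` and `m`, so their average
      -- separates the two empirical values.
      obtain ⟨δ, hδ, hδs⟩ := exists_forall_closedBall_abs_mean_sub_lt hGlaw hGindep
        (measurable_uncurry_varTerm hf A)
        (ae_of_all _ fun x => (continuous_varTerm f A x).continuousAt) hB hB'
        (half_pos (sub_pos.2 hsm))
      refine ⟨δ, hδ, ?_⟩
      filter_upwards [hδs, hlln] with ω h1 h2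
      filter_upwards [h1, h2.eventually_lt_const
        (show variance f A m < (variance f A s + variance f A m) / 2 by linarith)] with n h3 h4 t ht
      have h5 := (abs_lt.1 (h3 t ht)).1
      rw [empVar_eq, empVar_eq]
      change -((variance f A s - variance f A m) / 2) < _ - variance f A s at h5
      linarith
    choose! δ hδ hδs using hloc
    obtain ⟨T, hTs, hT⟩ := (isCompact_sphere m ε).elim_nhds_subcover
      (fun s => Metric.closedBall s (δ s)) (fun s hs => Metric.closedBall_mem_nhds s (hδ s hs))
    have hall : ∀ᵐ ω ∂P, ∀ s ∈ T, ∀ᶠ n : ℕ in atTop, ∀ t ∈ Metric.closedBall s (δ s),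
        empVar f A (fun i => G i ω) n m < empVar f A (fun i => G i ω) n t :=
      (ae_ball_iff T.countable_toSet).2 fun s hs => hδs s (hTs s hs)
    filter_upwards [hall] with ω hω
    filter_upwards [(eventually_all_finset T).2 hω] with n hn t ht
    obtain ⟨s, hs, hts⟩ := Set.mem_iUnion₂.1 (hT ht)
    exact hn s hs t hts
  have hsph' : ∀ᵐ ω ∂P, ∀ k : ℕ, ∀ᶠ n : ℕ in atTop, ∀ t ∈ Metric.sphere m (1 / ((k : ℝ) + 1)),
      empVar f A (fun i => G i ω) n m < empVar f A (fun i => G i ω) n t :=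
    ae_all_iff.2 fun k => hsph _ (by positivity)
  filter_upwards [hlln, hsph'] with ω h1 h2
  rw [Metric.tendsto_nhds]
  intro ε hε
  obtain ⟨k, hk⟩ := exists_nat_one_div_lt hε
  filter_upwards [h2 k, h1.eventually_const_lt (variance_pos hf hf_ne hf_int A m)] with n h3 h4
  -- A positive empirical variance at `m` rules out the default value `0` of `optParam`.
  have hne : ∃ i < n, f (G i ω) ≠ 0 := by
    by_contra! h
    refine h4.ne' ?_
    rw [Finset.sum_eq_zero fun i hi => by simp [varTerm, h i (Finset.mem_range.1 hi)], mul_zero]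
  exact ((convexOn_empVar f A _ n).dist_lt_of_forall_sphere_lt (by positivity)
    (optParam_isMinimizer f A hA _ n hne) h3).trans hk

end RobustIS

/-! ### Domination and almost sure continuity of the estimator's integrand -/

namespace RobustIS

variable {d d' : ℕ}

/-- All moderate shifts of `g`, weighted by an exponential of the norm, have a common
Gaussian-integrable bound. -/
def ShiftDominated (g : EuclideanSpace ℝ (Fin d) → ℝ) : Prop :=
  ∀ R : ℝ, 0 < R → ∃ B : EuclideanSpace ℝ (Fin d) → ENNReal, Measurable B ∧
    ∫⁻ x, B x ∂stdGaussian (EuclideanSpace ℝ (Fin d)) ≠ ⊤ ∧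
    ∀ x θ, ‖θ‖ ≤ R → ‖g (x + θ) * Real.exp (R * ‖x‖)‖ₑ ≤ B x

theorem ShiftDominated.add {g h : EuclideanSpace ℝ (Fin d) → ℝ} (hg : ShiftDominated g)
    (hh : ShiftDominated h) : ShiftDominated fun x => g x + h x := by
  intro R hR
  obtain ⟨B, hBm, hB, hgB⟩ := hg R hR
  obtain ⟨C, hCm, hC, hhC⟩ := hh R hR
  refine ⟨fun x => B x + C x, hBm.add hCm, ?_, fun x θ hθ => ?_⟩
  · rw [lintegral_add_left hBm]
    exact ENNReal.add_ne_top.2 ⟨hB, hC⟩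
  · rw [add_mul]
    exact (enorm_add_le _ _).trans (add_le_add (hgB x θ hθ) (hhC x θ hθ))

theorem SubGaussianGrowth.shiftDominated {g : EuclideanSpace ℝ (Fin d) → ℝ}
    (hg : SubGaussianGrowth g) : ShiftDominated g := by
  intro R hR
  obtain ⟨lam, hlam, β, hβ0, hβ, hgle⟩ := hg
  have hint := (integrable_exp_rpow_norm_stdGaussian (E := EuclideanSpace ℝ (Fin d)) hβ0 hβ hR.le
    R).const_mul lam
  refine ⟨fun x => ‖lam * Real.exp ((‖x‖ + R) ^ β + R * ‖x‖)‖ₑ, by fun_prop, hint.2.ne,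
    fun x θ hθ => ?_⟩
  rw [enorm_le_iff_norm_le, norm_mul, Real.norm_eq_abs, Real.norm_eq_abs, Real.abs_exp,
    Real.norm_of_nonneg (by positivity), Real.exp_add, ← mul_assoc]
  refine mul_le_mul_of_nonneg_right ((hgle _).trans ?_) (Real.exp_pos _).le
  refine mul_le_mul_of_nonneg_left (Real.exp_le_exp.2 ?_) hlam.le
  exact Real.rpow_le_rpow (norm_nonneg _) ((norm_add_le _ _).trans (by linarith)) hβ0

/-- After bounding `exp (R * ‖x‖)` by finitely many `exp ⟨u, x⟩`, Cameron–Martin turns each weight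
into a shift by `u`, which enlarges the ball in the supremum to radius `R + ‖u‖`. Continuity makes
the supremum lower semicontinuous, hence measurable. -/
theorem shiftDominated_of_continuous {f₁ : EuclideanSpace ℝ (Fin d) → ℝ} (hf₁ : Continuous f₁)
    (hf₁_int : ∀ M : ℝ, 0 < M →
      ∫⁻ x, (⨆ θ ∈ Metric.closedBall (0 : EuclideanSpace ℝ (Fin d)) M, ‖f₁ (x + θ)‖ₑ)
        ∂(stdGaussian (EuclideanSpace ℝ (Fin d))) < ⊤) : ShiftDominated f₁ := by
  intro R hR
  obtain ⟨T, hT⟩ := exists_finset_exp_mul_norm_le (EuclideanSpace ℝ (Fin d)) R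
  let S : EuclideanSpace ℝ (Fin d) → ENNReal := fun x =>
    ⨆ θ ∈ Metric.closedBall (0 : EuclideanSpace ℝ (Fin d)) R, ‖f₁ (x + θ)‖ₑ
  have hS : Measurable S := (lowerSemicontinuous_biSup fun θ _ =>
    (by fun_prop : Continuous fun x => ‖f₁ (x + θ)‖ₑ).lowerSemicontinuous).measurable
  have hSint : ∀ u : EuclideanSpace ℝ (Fin d),
      ∫⁻ x, S x * ENNReal.ofReal (Real.exp (inner ℝ u x))
        ∂stdGaussian (EuclideanSpace ℝ (Fin d)) ≠ ⊤ := by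
    intro u
    have h1 : ∀ x, S x * ENNReal.ofReal (Real.exp (inner ℝ u x)) =
        ENNReal.ofReal (Real.exp (‖u‖ ^ 2 / 2)) * (ENNReal.ofReal (shiftDensity u x) * S x) := by
      intro x
      rw [← mul_assoc, ← ENNReal.ofReal_mul (Real.exp_pos _).le, shiftDensity, ← Real.exp_add,
        mul_comm]
      congr 3
      ring
    simp_rw [h1]
    rw [lintegral_const_mul' _ _ ENNReal.ofReal_ne_top, ← lintegral_stdGaussian_add_const hS]
    refine ENNReal.mul_ne_top ENNReal.ofReal_ne_top
      (((lintegral_mono fun x => ?_).trans_lt (hf₁_int (R + ‖u‖) (by positivity))).ne)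
    refine iSup₂_le fun θ hθ => ?_
    have hmem : u + θ ∈ Metric.closedBall (0 : EuclideanSpace ℝ (Fin d)) (R + ‖u‖) := by
      rw [mem_closedBall_zero_iff] at hθ ⊢
      exact (norm_add_le _ _).trans (by linarith)
    rw [add_assoc]
    exact le_iSup₂ (f := fun θ _ => ‖f₁ (x + θ)‖ₑ) (u + θ) hmem
  refine ⟨fun x => ∑ u ∈ T, S x * ENNReal.ofReal (Real.exp (inner ℝ u x)), by fun_prop, ?_,
    fun x θ hθ => ?_⟩
  · rw [lintegral_finsetSum _ fun u _ => by fun_prop]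
    exact (ENNReal.sum_lt_top.2 fun u _ => (hSint u).lt_top).ne
  · beta_reduce
    rw [enorm_mul, ← Finset.mul_sum,
      ← ENNReal.ofReal_sum_of_nonneg fun u _ => (Real.exp_pos _).le,
      Real.enorm_of_nonneg (Real.exp_pos _).le]
    exact mul_le_mul' (le_iSup₂ (f := fun θ _ => ‖f₁ (x + θ)‖ₑ) θ (by simpa using hθ))
      (ENNReal.ofReal_le_ofReal (hT x))

/-- The integrand of the importance sampling estimator at the parameter `Aϑ`. -/
noncomputable def estTerm (f : EuclideanSpace ℝ (Fin d) → ℝ) (A : Matrix (Fin d) (Fin d') ℝ)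
    (x : EuclideanSpace ℝ (Fin d)) (ϑ : EuclideanSpace ℝ (Fin d')) : ℝ :=
  f (x + lift A ϑ) * Real.exp (-(inner ℝ (lift A ϑ) x) - ‖lift A ϑ‖ ^ 2 / 2)

theorem measurable_uncurry_estTerm {f : EuclideanSpace ℝ (Fin d) → ℝ} (hf : Measurable f)
    (A : Matrix (Fin d) (Fin d') ℝ) : Measurable (Function.uncurry (estTerm f A)) := by
  unfold estTerm Function.uncurry
  fun_prop

theorem ShiftDominated.exists_forall_closedBall_enorm_estTerm_le
    {f : EuclideanSpace ℝ (Fin d) → ℝ} (hf : ShiftDominated f) (A : Matrix (Fin d) (Fin d') ℝ)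
    (t₀ : EuclideanSpace ℝ (Fin d')) :
    ∃ B : EuclideanSpace ℝ (Fin d) → ENNReal,
      (∀ x, ∀ t ∈ Metric.closedBall t₀ 1, ‖estTerm f A x t‖ₑ ≤ B x) ∧
      ∫⁻ x, B x ∂stdGaussian (EuclideanSpace ℝ (Fin d)) ≠ ⊤ := by
  obtain ⟨R, hR, hA⟩ := exists_forall_closedBall_norm_lift_le A t₀
  obtain ⟨B, -, hB, hfB⟩ := hf R hR
  refine ⟨B, fun x t ht => le_trans ?_ (hfB x (lift A t) (hA t ht)), hB⟩
  rw [estTerm, enorm_le_iff_norm_le, norm_mul, norm_mul]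
  refine mul_le_mul_of_nonneg_left ?_ (norm_nonneg _)
  rw [Real.norm_eq_abs, Real.abs_exp, Real.norm_eq_abs, Real.abs_exp, Real.exp_le_exp]
  have h1 := neg_le_of_abs_le (abs_real_inner_le_norm (lift A t) x)
  have h2 := mul_le_mul_of_nonneg_right (hA t ht) (norm_nonneg x)
  have h3 := sq_nonneg ‖lift A t‖
  linarith

theorem DirMonotonic.countable_not_continuousAt {a : EuclideanSpace ℝ (Fin d)}
    {h : EuclideanSpace ℝ (Fin d) → ℝ} (hh : DirMonotonic a h) (x : EuclideanSpace ℝ (Fin d)) :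
    {t : ℝ | ¬ ContinuousAt (fun t : ℝ => h (x + t • a)) t}.Countable := by
  rcases hh with hh | hh
  · exact (hh x).countable_not_continuousAt
  · exact (hh x).countable_not_continuousAt

theorem ClassV.countable_not_continuousAt {a : EuclideanSpace ℝ (Fin d)}
    {h : EuclideanSpace ℝ (Fin d) → ℝ} (hh : ClassV a h) (x : EuclideanSpace ℝ (Fin d)) :
    {t : ℝ | ¬ ContinuousAt (fun t : ℝ => h (x + t • a)) t}.Countable := by
  obtain ⟨g₁, g₂, hg₁, hg₂, -, -, hsum⟩ := hh
  refine ((hg₁.countable_not_continuousAt x).union (hg₂.countable_not_continuousAt x)).mono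
    fun t ht => ?_
  by_contra hcon
  rw [Set.mem_union, not_or] at hcon
  refine ht ?_
  simp_rw [hsum]
  exact (not_not.1 hcon.1).add (not_not.1 hcon.2)

theorem ClassV.shiftDominated {a : EuclideanSpace ℝ (Fin d)}
    {h : EuclideanSpace ℝ (Fin d) → ℝ} (hh : ClassV a h) : ShiftDominated h := by
  obtain ⟨g₁, g₂, -, -, hg₁, hg₂, hsum⟩ := hh
  rw [funext hsum]
  exact hg₁.shiftDominated.add hg₂.shiftDominated

theorem lift_fin_one (A : Matrix (Fin d) (Fin 1) ℝ) (t : EuclideanSpace ℝ (Fin 1)) :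
    lift A t = t 0 • WithLp.toLp 2 (A.col 0) := by
  ext i
  simp [lift, Matrix.mulVec, dotProduct, mul_comm]

/-- Almost surely, sums of a continuous function and a function of the class `𝒱_A` are continuous
at a given parameter along the direction `A`. -/
theorem ae_continuousAt_comp_add_lift {f f₁ f₂ : EuclideanSpace ℝ (Fin d) → ℝ} (hf : Measurable f)
    (A : Matrix (Fin d) (Fin 1) ℝ) (hdecomp : ∀ x, f x = f₁ x + f₂ x) (hf₁ : Continuous f₁)
    (hf₂ : ClassV (WithLp.toLp 2 (A.col 0)) f₂) (t₀ : EuclideanSpace ℝ (Fin 1)) :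
    ∀ᵐ x ∂stdGaussian (EuclideanSpace ℝ (Fin d)),
      ContinuousAt (fun t => f (x + lift A t)) t₀ := by
  set a : EuclideanSpace ℝ (Fin d) := WithLp.toLp 2 (A.col 0) with ha
  have hmeas : Measurable (Function.uncurry fun x t => f (x + lift A t)) := by
    unfold Function.uncurry
    fun_prop
  -- Measurability is argued for `f`, which is Borel; `f₂` alone need not be measurable.
  refine stdGaussian_eq_zero_of_countable_lines
    (nullMeasurableSet_continuousAt (stdGaussian _) hmeas t₀).compl a fun x => ?_
  -- On the line `x + τ • a` only `f₂` can fail to be continuous, and only if `τ + t₀ 0` is a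
  -- discontinuity of `s ↦ f₂ (x + s • a)`.
  have hc : ((· + t₀ 0) ⁻¹'
      {s : ℝ | ¬ ContinuousAt (fun s : ℝ => f₂ (x + s • a)) s}).Countable :=
    (hf₂.countable_not_continuousAt x).preimage (add_left_injective (t₀ 0))
  refine hc.mono ?_
  intro τ hτ
  simp only [Set.mem_ofPred_eq, Set.mem_compl_iff, Set.mem_preimage] at hτ ⊢
  refine fun hcon => hτ ?_
  have h1 : (fun t => f (x + τ • a + lift A t)) = fun t : EuclideanSpace ℝ (Fin 1) =>
      f₁ (x + τ • a + lift A t) + f₂ (x + (τ + t 0) • a) := by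
    ext t
    rw [hdecomp, lift_fin_one, ← ha, add_smul, ← add_assoc]
  change ContinuousAt (fun t => f (x + τ • a + lift A t)) t₀
  rw [h1]
  have h2 := continuous_lift A
  refine (by fun_prop : Continuous fun t => f₁ (x + τ • a + lift A t)).continuousAt.add ?_
  exact ContinuousAt.comp (f := fun t : EuclideanSpace ℝ (Fin 1) => τ + t 0)
    (g := fun s : ℝ => f₂ (x + s • a)) hcon (by fun_prop)

end RobustIS

/-! ### The convergence theorem -/

theorem theorem2p2
    {d d' : ℕ} (A : Matrix (Fin d) (Fin d') ℝ) (hA : A.rank = d')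
    {Ω : Type*} [MeasurableSpace Ω] (P : Measure Ω) [IsProbabilityMeasure P]
    -- an i.i.d. sequence of standard normal vectors of `ℝ^d`
    (G : ℕ → Ω → EuclideanSpace ℝ (Fin d))
    (hGlaw : ∀ i, HasLaw (G i) (stdGaussian (EuclideanSpace ℝ (Fin d))) P)
    (hGindep : iIndepFun G P)
    (f : EuclideanSpace ℝ (Fin d) → ℝ) (hf : Measurable f)
    -- `f(G)` is not almost surely zero
    (hf_ne : 0 < stdGaussian (EuclideanSpace ℝ (Fin d)) {x | f x ≠ 0})
    -- `E(f²(G) e^{-θ·G}) < ∞` for every `θ`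
    (hf_int : ∀ θ : EuclideanSpace ℝ (Fin d),
      Integrable (fun x => f x ^ 2 * Real.exp (-(inner ℝ θ x)))
        (stdGaussian (EuclideanSpace ℝ (Fin d))))
    -- the decomposition `f = f₁ + 1_{d' = 1} f₂`
    (f₁ f₂ : EuclideanSpace ℝ (Fin d) → ℝ)
    (hdecomp : ∀ x, f x = f₁ x + if d' = 1 then f₂ x else 0)
    (hf₁ : Continuous f₁)
    (hf₁_int : ∀ M : ℝ, 0 < M →
      ∫⁻ x, (⨆ θ ∈ Metric.closedBall (0 : EuclideanSpace ℝ (Fin d)) M, ‖f₁ (x + θ)‖ₑ)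
        ∂(stdGaussian (EuclideanSpace ℝ (Fin d))) < ⊤)
    -- when `d' = 1`, the single column of `A` is the direction of the class `𝒱_A`
    (hf₂ : ∀ j : Fin d', d' = 1 → RobustIS.ClassV (WithLp.toLp 2 (A.col j)) f₂)
    (ν : ℕ → ℕ) (hν : Tendsto ν atTop atTop) :
    ∀ᵐ ω ∂P, Tendsto
      (fun n => RobustIS.estimator f (fun i => G i ω) n
        (RobustIS.lift A (RobustIS.optParam f A (fun i => G i ω) (ν n))))
      atTop (𝓝 (∫ x, f x ∂(stdGaussian (EuclideanSpace ℝ (Fin d))))) := by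
  obtain ⟨m, hm⟩ := RobustIS.exists_tendsto_optParam hGlaw hGindep hA hf hf_ne hf_int
  have hdom₁ := RobustIS.shiftDominated_of_continuous hf₁ hf₁_int
  have hlift := RobustIS.continuous_lift A
  have key : RobustIS.ShiftDominated f ∧
      ∀ᵐ x ∂stdGaussian (EuclideanSpace ℝ (Fin d)),
        ContinuousAt (fun t => f (x + RobustIS.lift A t)) m := by
    by_cases hd : d' = 1
    · subst hd
      simp only [if_true] at hdecomp
      have hV := hf₂ 0 rfl
      refine ⟨?_, RobustIS.ae_continuousAt_comp_add_lift hf A hdecomp hf₁ hV m⟩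
      rw [funext hdecomp]
      exact hdom₁.add hV.shiftDominated
    · simp only [hd, if_false, add_zero] at hdecomp
      obtain rfl : f = f₁ := funext hdecomp
      exact ⟨hdom₁, ae_of_all _ fun x => (by fun_prop : Continuous _).continuousAt⟩
  obtain ⟨hdom, hcont⟩ := key
  obtain ⟨B, hB, hB'⟩ := hdom.exists_forall_closedBall_enorm_estTerm_le A m
  have hcont' : ∀ᵐ x ∂stdGaussian (EuclideanSpace ℝ (Fin d)),
      ContinuousAt (RobustIS.estTerm f A x) m := by
    filter_upwards [hcont] with x hx
    exact hx.mul (by fun_prop : Continuous fun t => Real.exp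
      (-(inner ℝ (RobustIS.lift A t) x) - ‖RobustIS.lift A t‖ ^ 2 / 2)).continuousAt
  have hmean : ∫ x, RobustIS.estTerm f A x m ∂stdGaussian (EuclideanSpace ℝ (Fin d)) =
      ∫ x, f x ∂stdGaussian (EuclideanSpace ℝ (Fin d)) :=
    integral_shift_mul_exp_stdGaussian hf _
  -- Countably many tolerances leave a single exceptional null set.
  have hloc := fun k : ℕ => exists_forall_closedBall_abs_mean_sub_lt hGlaw hGindep
    (RobustIS.measurable_uncurry_estTerm hf A) hcont' hB hB' (ε := 1 / ((k : ℝ) + 1))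
    (by positivity)
  choose δ hδ hδm using hloc
  filter_upwards [hm, ae_all_iff.2 hδm] with ω h1 h2
  rw [Metric.tendsto_nhds]
  intro ε hε
  obtain ⟨k, hk⟩ := exists_nat_one_div_lt hε
  -- The estimate is uniform over the ball around `m`, so it applies to the random parameter with
  -- index `ν n` as soon as that parameter enters the ball.
  filter_upwards [h2 k, (h1.comp hν).eventually (Metric.closedBall_mem_nhds m (hδ k))] with n h3 h4
  have h5 := h3 _ h4
  rw [hmean] at h5
  exact h5.trans hk
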